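/- Let $n,N\ge 1$ be integers and let $\Omega\subset\mathbb R^n$ be a Borel set with finite Lebesgue measure $|\Omega|<\infty$. For $1\le i\le N$ let $f_i\in L^\infty(\Omega)$ with $f_i\ge 0$ a.e. on $\Omega$, and let $g_i\in L^2(\Omega)$ (all functions are real-valued). Let $W^{1,2}(\mathbb R^n)$ denote the set of functions $u\in L^2_{\rm loc}(\mathbb R^n)$ whose distributional gradient $\nabla u$ lies in $L^2(\mathbb R^n)$. Let $\mathcal W$ be the set of $N$-tuples $\mathbf W=(W_1,\dots,W_N)$ of pairwise disjoint Borel subsets of $\Omega$, and let $\mathcal F$ be the set of pairs $(\mathbf u,\mathbf W)$ with $\mathbf W\in\mathcal W$ and $\mathbf u=(u_1,\dots,u_N)$, where $u_i\in W^{1,2}(\mathbb R^n)$ and $u_i=0$ a.e. on $\mathbb R^n\setminus W_i$ for each $i$. For a function $F:\mathcal W\to\mathbb R$ put $$J(\mathbf u,\mathbf W)=\sum_{i=1}^N\int_{\mathbb R^n}|\nabla u_i|^2\,dx+\sum_{i=1}^N\int_\Omega\bigl[u_i^2f_i-u_ig_i\bigr]\,dx+F(\mathbf W).$$ Then, for every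 $(\mathbf u,\mathbf W)\in\mathcal F$ and every $i$, the functions $|\nabla u_i|^2$ on $\mathbb R^n$ and $u_i^2f_i$, $u_ig_i$ on $\Omega$ are integrable, so that $J$ is well defined and finite on $\mathcal F$. Moreover: 1. If $F(\mathbf W)=\widetilde F(|W_1|,\dots,|W_N|)$ for some continuous function $\widetilde F:[0,|\Omega|]^N\to\mathbb R$, then there is $(\mathbf u_0,\mathbf W_0)\in\mathcal F$ such that $J(\mathbf u_0,\mathbf W_0)\le J(\mathbf u,\mathbf W)$ for all $(\mathbf u,\mathbf W)\in\mathcal F$. 2. The same conclusion holds if, instead, $F:\mathcal W\to\mathbb R$ is nondecreasing, that is, $F(\mathbf W)\le F(\mathbf W')$ whenever $\mathbf W,\mathbf W'\in\mathcal W$ and $W_i\subset W_i'$ for all $i$, and continuous, that is, $F(\mathbf W_k)\to F(\mathbf W)$ whenever $\mathbf W,\mathbf W_k\in\mathcal W$ and $\lim_{k\to\infty}|W_i\,\Delta\, W_{i,k}|=0$ for all $i$. -/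

import Mathlib

open MeasureTheory Filter Topology
open scoped ContDiff symmDiff

namespace Partition

/-- `G` is the gradient of `u` on `ℝⁿ` in the sense of distributions: both are locally integrable,
and `∫ u ∂_v φ = - ∫ ⟨G, v⟩ φ` for every test function `φ` and every direction `v`. -/
def HasWeakGradient {n : ℕ} (u : EuclideanSpace ℝ (Fin n) → ℝ)
    (G : EuclideanSpace ℝ (Fin n) → EuclideanSpace ℝ (Fin n)) : Prop :=
  LocallyIntegrable u volume ∧ LocallyIntegrable G volume ∧
    ∀ φ : EuclideanSpace ℝ (Fin n) → ℝ, ContDiff ℝ ∞ φ → HasCompactSupport φ →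
      ∀ v : EuclideanSpace ℝ (Fin n),
        ∫ x, u x * fderiv ℝ φ x v = - ∫ x, inner ℝ (G x) v * φ x

/-- The distributional gradient is unique up to a null set. -/
theorem HasWeakGradient.ae_eq {n : ℕ} {u : EuclideanSpace ℝ (Fin n) → ℝ}
    {G H : EuclideanSpace ℝ (Fin n) → EuclideanSpace ℝ (Fin n)}
    (hG : HasWeakGradient u G) (hH : HasWeakGradient u H) : G =ᵐ[volume] H := by
  refine ae_eq_of_integral_contDiff_smul_eq hG.2.1 hH.2.1 ?_
  intro φ hφ hc
  have key : ∀ K : EuclideanSpace ℝ (Fin n) → EuclideanSpace ℝ (Fin n),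
      LocallyIntegrable K volume → ∀ v : EuclideanSpace ℝ (Fin n),
      inner ℝ v (∫ x, φ x • K x) = ∫ x, inner ℝ (K x) v * φ x := by
    intro K hK v
    rw [← integral_inner (hK.integrable_smul_left_of_hasCompactSupport hφ.continuous hc)]
    refine integral_congr_ae (Eventually.of_forall fun x => ?_)
    simp only [real_inner_smul_right, real_inner_comm, mul_comm]
  refine ext_inner_left ℝ fun v => ?_
  rw [key G hG.2.1 v, key H hH.2.1 v]
  have h1 := hG.2.2 φ hφ hc v
  have h2 := hH.2.2 φ hφ hc v
  linarith

/-- The space `W^{1,2}(ℝⁿ)`, with the convention that `u` is only required to be in `L²_loc`, and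
its distributional gradient in `L²`. -/
def MemW12 {n : ℕ} (u : EuclideanSpace ℝ (Fin n) → ℝ) : Prop :=
  (∀ K : Set (EuclideanSpace ℝ (Fin n)), IsCompact K → MemLp u 2 (volume.restrict K)) ∧
    ∃ G : EuclideanSpace ℝ (Fin n) → EuclideanSpace ℝ (Fin n),
      HasWeakGradient u G ∧ MemLp G 2 volume

open scoped Classical in
/-- The distributional gradient `∇u` of `u` (a representative, unique up to a null set), with the
value `0` if `u` has none. -/
noncomputable def weakGradient {n : ℕ} (u : EuclideanSpace ℝ (Fin n) → ℝ) :
    EuclideanSpace ℝ (Fin n) → EuclideanSpace ℝ (Fin n) :=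
  if h : ∃ G : EuclideanSpace ℝ (Fin n) → EuclideanSpace ℝ (Fin n), HasWeakGradient u G
  then h.choose else 0

/-- The `N`-tuples of pairwise disjoint Borel subsets of `Ω`. -/
def disjointTuples {n : ℕ} (N : ℕ) (Ω : Set (EuclideanSpace ℝ (Fin n))) :
    Set (Fin N → Set (EuclideanSpace ℝ (Fin n))) :=
  {W | (∀ i, MeasurableSet (W i)) ∧ (∀ i, W i ⊆ Ω) ∧ Pairwise fun i j => Disjoint (W i) (W j)}

/-- The class of admissible pairs `(u, W)`. -/
def admissiblePairs {n : ℕ} (N : ℕ) (Ω : Set (EuclideanSpace ℝ (Fin n))) :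
    Set ((Fin N → EuclideanSpace ℝ (Fin n) → ℝ) × (Fin N → Set (EuclideanSpace ℝ (Fin n)))) :=
  {p | p.2 ∈ disjointTuples N Ω ∧ (∀ i, MemW12 (p.1 i)) ∧
    ∀ i, ∀ᵐ x ∂(volume.restrict (p.2 i)ᶜ), p.1 i x = 0}

/-- The energy `E(u) = ∑ ∫ |∇uᵢ|²`. -/
noncomputable def energy {n N : ℕ} (u : Fin N → EuclideanSpace ℝ (Fin n) → ℝ) : ℝ :=
  ∑ i, ∫ x, ‖weakGradient (u i) x‖ ^ 2

/-- The term `M(u) = ∑ ∫_Ω (uᵢ² fᵢ - uᵢ gᵢ)`. -/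
noncomputable def massTerm {n N : ℕ} (Ω : Set (EuclideanSpace ℝ (Fin n)))
    (f g u : Fin N → EuclideanSpace ℝ (Fin n) → ℝ) : ℝ :=
  ∑ i, ∫ x in Ω, (u i x ^ 2 * f i x - u i x * g i x)

/-- The functional `J(u, W) = E(u) + M(u) + F(W)`. -/
noncomputable def functionalJ {n N : ℕ} (Ω : Set (EuclideanSpace ℝ (Fin n)))
    (f g : Fin N → EuclideanSpace ℝ (Fin n) → ℝ)
    (F : (Fin N → Set (EuclideanSpace ℝ (Fin n))) → ℝ)
    (p : (Fin N → EuclideanSpace ℝ (Fin n) → ℝ) × (Fin N → Set (EuclideanSpace ℝ (Fin n)))) : ℝ :=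
  energy p.1 + massTerm Ω f g p.1 + F p.2

/-- `F` is nondecreasing on the `N`-tuples of disjoint Borel subsets of `Ω`. -/
def IsMonotoneTerm {n N : ℕ} (Ω : Set (EuclideanSpace ℝ (Fin n)))
    (F : (Fin N → Set (EuclideanSpace ℝ (Fin n))) → ℝ) : Prop :=
  ∀ W ∈ disjointTuples N Ω, ∀ W' ∈ disjointTuples N Ω, (∀ i, W i ⊆ W' i) → F W ≤ F W'

/-- `F` is continuous on the `N`-tuples of disjoint Borel subsets of `Ω`: `F(W_k) → F(W)` whenever
`|W_i ∆ W_{i,k}| → 0` for every `i`. -/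
def IsContinuousTerm {n N : ℕ} (Ω : Set (EuclideanSpace ℝ (Fin n)))
    (F : (Fin N → Set (EuclideanSpace ℝ (Fin n))) → ℝ) : Prop :=
  ∀ W ∈ disjointTuples N Ω, ∀ Wk : ℕ → Fin N → Set (EuclideanSpace ℝ (Fin n)),
    (∀ k, Wk k ∈ disjointTuples N Ω) →
    (∀ i, Tendsto (fun k => volume (W i ∆ Wk k i)) atTop (𝓝 0)) →
    Tendsto (fun k => F (Wk k)) atTop (𝓝 (F W))

end Partition

/-! The proof is the direct method. Each `u i` vanishes outside Ω, which has finite measure, so a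
Poincaré inequality (`exists_poincare_constant`) puts it in L²(ℝⁿ). Since `f i ≥ 0`, only the linear
term can be negative, and Poincaré lets the Dirichlet energy absorb it
(`exists_componentEnergy_ge`). Hence a minimizing sequence has bounded gradients, and along a
subsequence functions and gradients converge weakly in L².

Ω may be unbounded and irregular, so compactness comes from translations. Duality with test
functions gives ‖u(· + h) - u‖₂ ≤ |h| ‖∇u‖₂ (`eLpNorm_translate_sub_le`). Averaged over a ball so
large that most translates leave Ω, this is Poincaré. Averaged over a small ball, it says that u is
close in L² to its ball averages; these converge under weak convergence, and finiteness of |Ω|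
allows dominated convergence. This yields strong L² convergence
(`tendsto_eLpNorm_sub_of_tendsto_inner`).

The energy and mass terms are convex, hence lie above their tangents at the limit, and weak
convergence suffices to pass to the limit in the tangents. Strong convergence is needed for the
sets: after a further extraction the functions converge a.e., so the supports S of the limits are
disjoint up to null sets and |S_i \ W_{k,i}| → 0 (`exists_disjointTuples_of_ae_tendsto`). The sets
W_k themselves need not converge. It remains to find disjoint W_i ⊇ S_i with F(W) at most the limit
of the available upper bounds for F(W_k); this is the last hypothesis of `exists_minimizer`. For a
function of volumes, S is enlarged to limit volumes of the W_k; for a monotone continuous F, S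
itself works. -/

namespace Partition

/-! ### Weak sequential compactness in Hilbert spaces. -/

section Hilbert

variable {H : Type*} [NormedAddCommGroup H] [InnerProductSpace ℝ H] [CompleteSpace H]
  [SecondCountableTopology H]

/-- Bounded sequences in a separable Hilbert space have weakly convergent subsequences. -/
theorem exists_weak_limit (x : ℕ → H) {C : ℝ} (hx : ∀ k, ‖x k‖ ≤ C) :
    ∃ (y : H) (s : ℕ → ℕ), StrictMono s ∧
      ∀ v, Tendsto (fun k => inner ℝ (x (s k)) v) atTop (𝓝 (inner ℝ y v)) := by
  -- Sequential Banach–Alaoglu, where separability enters, is transported to H by the Riesz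
  -- isometry.
  obtain ⟨L, -, s, hs, hL⟩ := WeakDual.isSeqCompact_closedBall ℝ H 0 C
    (x := fun k => StrongDual.toWeakDual (InnerProductSpace.toDual ℝ H (x k))) (fun k => by
      simpa using hx k)
  refine ⟨(InnerProductSpace.toDual ℝ H).symm (WeakDual.toStrongDual L), s, hs, fun v => ?_⟩
  have h := (WeakDual.eval_continuous (𝕜 := ℝ) v).tendsto L |>.comp hL
  rw [InnerProductSpace.toDual_symm_apply]
  exact h

/-- Passing to the ℓ² product of copies of H gives one subsequence for all components at once;
testing against vectors supported in a single coordinate recovers the components. -/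
theorem exists_weak_limit_pi {ι : Type*} [Fintype ι]
    (x : ℕ → ι → H) {C : ℝ} (hx : ∀ k i, ‖x k i‖ ≤ C) :
    ∃ (y : ι → H) (s : ℕ → ℕ), StrictMono s ∧
      ∀ i v, Tendsto (fun k => inner ℝ (x (s k) i) v) atTop (𝓝 (inner ℝ (y i) v)) := by
  classical
  have hb : ∀ k, ‖(WithLp.toLp 2 (x k) : PiLp 2 fun _ : ι => H)‖ ≤ √(∑ _i : ι, C ^ 2) := by
    intro k
    rw [PiLp.norm_eq_of_L2]
    refine Real.sqrt_le_sqrt (Finset.sum_le_sum fun i _ => ?_)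
    exact pow_le_pow_left₀ (norm_nonneg _) (hx k i) 2
  obtain ⟨y, s, hs, h⟩ := exists_weak_limit (fun k => WithLp.toLp 2 (x k)) hb
  refine ⟨y, s, hs, fun i v => ?_⟩
  have := h (WithLp.toLp 2 (Pi.single i v))
  simp only [PiLp.inner_apply] at this
  have key : ∀ z : ι → H, ∑ j, inner ℝ (z j) ((Pi.single i v : ι → H) j) = inner ℝ (z i) v := by
    intro z
    rw [Finset.sum_eq_single i] <;> simp +contextual
  simpa only [key] using this

end Hilbert

/-! ### Subsets of prescribed Lebesgue measure. -/

section Volume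

variable {n : ℕ}

/-- Lebesgue measure takes all intermediate values on the subsets of a set of finite measure. -/
theorem exists_measurableSet_subset_volume_eq (hn : 1 ≤ n) {A : Set (EuclideanSpace ℝ (Fin n))}
    (hA : MeasurableSet A) (hfin : volume A < ⊤) {d : ℝ} (hd0 : 0 ≤ d)
    (hd : d ≤ volume.real A) : ∃ B ⊆ A, MeasurableSet B ∧ volume.real B = d := by
  rcases eq_or_lt_of_le hd with rfl | hlt
  · exact ⟨A, subset_rfl, hA, rfl⟩
  have : Nonempty (Fin n) := ⟨⟨0, hn⟩⟩
  have hnt : Nontrivial (EuclideanSpace ℝ (Fin n)) := inferInstance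
  -- |A ∩ B_r| is continuous in r because spheres are null, and it grows from 0 to |A|, so the
  -- intermediate value theorem applies.
  set m : ℝ → ℝ := fun r => volume.real (A ∩ Metric.ball 0 r) with hm
  have hmeas : ∀ r, MeasurableSet (A ∩ Metric.ball 0 r) := fun r => hA.inter measurableSet_ball
  have hcont : Continuous m := by
    refine continuous_iff_continuousAt.2 fun r => ?_
    have : Tendsto (fun t => volume (A ∩ Metric.ball 0 t)) (𝓝 r)
        (𝓝 (volume (A ∩ Metric.ball 0 r))) := by
      refine tendsto_measure_of_ae_tendsto_indicator (𝓝 r) (hmeas r) hmeas hA hfin.ne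
        (Eventually.of_forall fun t => Set.inter_subset_left) ?_
      have h0 : volume (Metric.sphere (0 : EuclideanSpace ℝ (Fin n)) r) = 0 :=
        Measure.addHaar_sphere _ _ _
      filter_upwards [measure_eq_zero_iff_ae_notMem.1 h0] with x hx
      have hne : ‖x‖ ≠ r := by simpa using hx
      rcases hne.lt_or_gt with h | h
      · filter_upwards [lt_mem_nhds h] with t ht
        simp [h, ht]
      · filter_upwards [gt_mem_nhds h] with t ht
        simp [h.not_gt, ht.not_gt]
    exact (ENNReal.tendsto_toReal (measure_ne_top_of_subset Set.inter_subset_left hfin.ne)).comp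
      this
  have hlim : Tendsto m atTop (𝓝 (volume.real A)) := by
    refine (ENNReal.tendsto_toReal hfin.ne).comp ?_
    refine tendsto_measure_of_ae_tendsto_indicator atTop hA hmeas hA hfin.ne
        (Eventually.of_forall fun t => Set.inter_subset_left) (Eventually.of_forall fun x => ?_)
    filter_upwards [eventually_gt_atTop ‖x‖] with t ht
    simp [ht]
  obtain ⟨R, hR, hR0⟩ := ((hlim.eventually (lt_mem_nhds hlt)).and (eventually_ge_atTop 0)).exists
  have hmem : d ∈ Set.Icc (m 0) (m R) := ⟨by simpa [hm] using hd0, hR.le⟩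
  obtain ⟨r, -, hr⟩ := intermediate_value_Icc hR0 hcont.continuousOn hmem
  exact ⟨_, Set.inter_subset_left, hmeas r, hr⟩

/-- A set of finite measure contains disjoint sets of prescribed measures, if there is room. -/
theorem exists_pairwise_disjoint_volume_eq (hn : 1 ≤ n) {ι : Type*} (s : Finset ι)
    {A : Set (EuclideanSpace ℝ (Fin n))} (hA : MeasurableSet A) (hfin : volume A < ⊤)
    {d : ι → ℝ} (hd0 : ∀ i ∈ s, 0 ≤ d i) (hd : ∑ i ∈ s, d i ≤ volume.real A) :
    ∃ T : ι → Set (EuclideanSpace ℝ (Fin n)), (∀ i ∈ s, MeasurableSet (T i) ∧ T i ⊆ A ∧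
      volume.real (T i) = d i) ∧ (s : Set ι).PairwiseDisjoint T := by
  classical
  induction s using Finset.induction_on generalizing A with
  | empty => exact ⟨fun _ => ∅, by simp, by simp⟩
  | insert a s ha ih =>
    rw [Finset.sum_insert ha] at hd
    have hs0 : 0 ≤ ∑ i ∈ s, d i :=
      Finset.sum_nonneg fun i hi => hd0 i (Finset.mem_insert_of_mem hi)
    obtain ⟨B, hBA, hB, hBd⟩ := exists_measurableSet_subset_volume_eq hn hA hfin
      (hd0 a (Finset.mem_insert_self a s)) (by linarith)
    have hdiff : volume.real (A \ B) = volume.real A - volume.real B :=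
      measureReal_sdiff hBA hB hfin.ne
    obtain ⟨T, hT, hTd⟩ := ih (hA.diff hB) ((measure_mono Set.sdiff_subset).trans_lt hfin)
      (fun i hi => hd0 i (Finset.mem_insert_of_mem hi)) (by linarith)
    refine ⟨Function.update T a B, fun i hi => ?_, ?_⟩
    · rcases eq_or_ne i a with rfl | hia
      · simpa using ⟨hB, hBA, hBd⟩
      · obtain ⟨h1, h2, h3⟩ := hT i ((Finset.mem_insert.1 hi).resolve_left hia)
        simpa [hia] using ⟨h1, h2.trans Set.sdiff_subset, h3⟩
    · rw [Finset.coe_insert, Set.pairwiseDisjoint_insert_of_notMem (by simpa using ha)]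
      constructor
      · intro i hi j hj hij
        have hia : i ≠ a := fun h => ha (h ▸ hi)
        have hja : j ≠ a := fun h => ha (h ▸ hj)
        simpa [Function.onFun, hia, hja] using hTd hi hj hij
      · intro i hi
        have hia : i ≠ a := fun h => ha (h ▸ hi)
        simp only [Function.update_self, Function.update_of_ne hia]
        exact (Set.disjoint_sdiff_right).mono_right (hT i hi).2.1

end Volume

/-! ### The L² norm by duality with test functions. -/

section Duality

variable {n : ℕ}

/-- A locally integrable function that is bounded for the `L²` norm against test functions is in
`L²`. -/
theorem eLpNorm_two_le_of_forall_integral_le {w : EuclideanSpace ℝ (Fin n) → ℝ}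
    (hw : LocallyIntegrable w volume) {C : ℝ} (hC : 0 ≤ C)
    (h : ∀ φ : EuclideanSpace ℝ (Fin n) → ℝ, ContDiff ℝ ∞ φ → HasCompactSupport φ →
      |∫ x, φ x * w x| ≤ C * (eLpNorm φ 2 volume).toReal) :
    eLpNorm w 2 volume ≤ ENNReal.ofReal C := by
  -- The L² classes with a test function as representative. Integration against `w` is a bounded
  -- functional there; Hahn–Banach extends it to L² without increasing the norm, Riesz represents
  -- the extension by `v`, and `v = w` a.e. because both act alike on test functions.
  let p : Submodule ℝ (Lp ℝ 2 (volume : Measure (EuclideanSpace ℝ (Fin n)))) :=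
    { carrier := {a | ∃ φ : EuclideanSpace ℝ (Fin n) → ℝ, ContDiff ℝ ∞ φ ∧ HasCompactSupport φ ∧
        a =ᵐ[volume] φ}
      add_mem' := by
        rintro a b ⟨φ, h1, h2, h3⟩ ⟨ψ, h4, h5, h6⟩
        exact ⟨φ + ψ, h1.add h4, h2.add h5, (Lp.coeFn_add a b).trans (h3.add h6)⟩
      zero_mem' := ⟨0, contDiff_const, HasCompactSupport.zero, Lp.coeFn_zero _ _ _⟩
      smul_mem' := by
        rintro c a ⟨φ, h1, h2, h3⟩
        exact ⟨c • φ, h1.const_smul c, h2.smul_left (f := fun _ => c),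
          (Lp.coeFn_smul c a).trans (h3.const_smul c)⟩ }
  have hint : ∀ a ∈ p, Integrable (fun x => a x * w x) volume := by
    rintro a ⟨φ, h1, h2, h3⟩
    refine (hw.integrable_smul_left_of_hasCompactSupport h1.continuous h2).congr ?_
    filter_upwards [h3] with x hx
    simp [hx]
  have hbound : ∀ a ∈ p, ‖∫ x, a x * w x‖ ≤ C * ‖a‖ := by
    rintro a ⟨φ, h1, h2, h3⟩
    have := h φ h1 h2
    rw [Lp.norm_def, eLpNorm_congr_ae h3, Real.norm_eq_abs]
    convert this using 2
    refine integral_congr_ae ?_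
    filter_upwards [h3] with x hx
    simp [hx]
  let T : p →ₗ[ℝ] ℝ :=
    { toFun := fun a => ∫ x, (a : Lp ℝ 2 (volume : Measure (EuclideanSpace ℝ (Fin n)))) x * w x
      map_add' := by
        intro a b
        rw [← integral_add (hint a a.2) (hint b b.2)]
        refine integral_congr_ae ?_
        filter_upwards [Lp.coeFn_add (a : Lp ℝ 2 volume) b] with x hx
        simp only [Submodule.coe_add, hx, Pi.add_apply, add_mul]
      map_smul' := by
        intro c a
        rw [RingHom.id_apply, smul_eq_mul, ← integral_const_mul]
        refine integral_congr_ae ?_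
        filter_upwards [Lp.coeFn_smul c (a : Lp ℝ 2 volume)] with x hx
        simp only [Submodule.coe_smul, hx, Pi.smul_apply, smul_eq_mul, mul_assoc] }
  obtain ⟨S, hS, hSn⟩ := exists_extension_norm_eq p (T.mkContinuous C fun a => hbound a a.2)
  set v := (InnerProductSpace.toDual ℝ (Lp ℝ 2 volume)).symm S with hv
  have hvn : ‖v‖ ≤ C := by
    rw [hv, LinearIsometryEquiv.norm_map, hSn]
    exact LinearMap.mkContinuous_norm_le _ hC _
  have hvw : ∀ᵐ x ∂volume, v x = w x := by
    refine ae_eq_of_integral_contDiff_smul_eq ((Lp.memLp v).locallyIntegrable one_le_two) hw ?_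
    intro φ h1 h2
    have hφ : MemLp φ 2 volume := h1.continuous.memLp_of_hasCompactSupport h2
    have hmem : hφ.toLp φ ∈ p := ⟨φ, h1, h2, hφ.coeFn_toLp⟩
    have e1 : inner ℝ v (hφ.toLp φ) = ∫ x, (hφ.toLp φ) x * w x := by
      rw [hv, InnerProductSpace.toDual_symm_apply]
      exact hS ⟨_, hmem⟩
    rw [L2.inner_def] at e1
    calc ∫ x, φ x • v x = ∫ x, inner ℝ (v x) ((hφ.toLp φ) x) := by
          refine integral_congr_ae ?_
          filter_upwards [hφ.coeFn_toLp] with x hx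
          simp [hx]
      _ = _ := by
          rw [e1]
          refine integral_congr_ae ?_
          filter_upwards [hφ.coeFn_toLp] with x hx
          simp [hx]
  rw [← eLpNorm_congr_ae hvw]
  rw [Lp.norm_def] at hvn
  exact (ENNReal.le_ofReal_iff_toReal_le (Lp.memLp v).2.ne hC).2 hvn

end Duality

end Partition

namespace Partition

/-! ### Translation estimate and Poincaré inequality. -/

section Translation

variable {n : ℕ} {u : EuclideanSpace ℝ (Fin n) → ℝ}
  {G : EuclideanSpace ℝ (Fin n) → EuclideanSpace ℝ (Fin n)}

theorem abs_integral_mul_le_eLpNorm_two {α : Type*} [MeasurableSpace α] {μ : Measure α}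
    {a b : α → ℝ} (ha : MemLp a 2 μ) (hb : MemLp b 2 μ) :
    |∫ x, a x * b x ∂μ| ≤ (eLpNorm a 2 μ).toReal * (eLpNorm b 2 μ).toReal := by
  have h := abs_real_inner_le_norm (ha.toLp a) (hb.toLp b)
  rw [L2.inner_def, Lp.norm_toLp, Lp.norm_toLp] at h
  convert h using 2
  refine integral_congr_ae ?_
  filter_upwards [ha.coeFn_toLp, hb.coeFn_toLp] with x h1 h2
  simp [h1, h2, mul_comm]

theorem _root_.MeasureTheory.LocallyIntegrable.comp_add_right
    (hu : LocallyIntegrable u volume) (h : EuclideanSpace ℝ (Fin n)) :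
    LocallyIntegrable (fun x => u (x + h)) volume := by
  rw [locallyIntegrable_iff] at hu ⊢
  intro K hK
  have hK' : IsCompact ((fun x => x + h) '' K) := hK.image (continuous_add_const h)
  have := ((measurePreserving_add_right volume h).integrableOn_comp_preimage
    (measurableEmbedding_addRight h)).2 (hu _ hK')
  rwa [Set.preimage_image_eq _ (add_left_injective h)] at this

theorem HasWeakGradient.congr_ae {v : EuclideanSpace ℝ (Fin n) → ℝ}
    (hu : HasWeakGradient u G) (h : u =ᵐ[volume] v) : HasWeakGradient v G := by
  refine ⟨hu.1.congr h, hu.2.1, fun φ h1 h2 z => ?_⟩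
  rw [← hu.2.2 φ h1 h2 z]
  refine integral_congr_ae ?_
  filter_upwards [h] with x hx
  rw [hx]

/-- The integral is the convolution of u with the reflection of φ, evaluated at t • h, so the
derivative may be put on the smooth factor. The weak gradient then moves it to u; the sign from
integration by parts cancels the one from differentiating φ(x - t • h) in t. -/
theorem hasDerivAt_integral_mul_translate (hu : HasWeakGradient u G)
    {φ : EuclideanSpace ℝ (Fin n) → ℝ} (h1 : ContDiff ℝ ∞ φ) (h2 : HasCompactSupport φ)
    (h : EuclideanSpace ℝ (Fin n)) (t : ℝ) :
    HasDerivAt (fun t : ℝ => ∫ x, u x * φ (x - t • h))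
      (∫ x, inner ℝ (G x) h * φ (x - t • h)) t := by
  have hg1 : ContDiff ℝ 1 (fun y => φ (-y)) := (h1.of_le (by simp)).comp contDiff_neg
  have hg2 : HasCompactSupport (fun y => φ (-y)) := h2.comp_homeomorph (Homeomorph.neg _)
  have hconv := hg2.hasFDerivAt_convolution_right (ContinuousLinearMap.mul ℝ ℝ) hu.1 hg1 (t • h)
  have hlin : HasDerivAt (fun t : ℝ => t • h) h t := by
    simpa using (hasDerivAt_id t).smul_const h
  have := hconv.comp_hasDerivAt t hlin
  rw [convolution_precompR_apply _ hu.1 (hg2.fderiv ℝ) (hg1.continuous_fderiv one_ne_zero)] at this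
  simp only [Function.comp_def, convolution_def, ContinuousLinearMap.mul_apply', neg_sub] at this
  have h3 : ContDiff ℝ ∞ (fun x => φ (x - t • h)) := h1.comp (contDiff_id.sub contDiff_const)
  have h4 : HasCompactSupport (fun x => φ (x - t • h)) :=
    h2.comp_homeomorph (Homeomorph.subRight (t • h))
  refine this.congr_deriv ?_
  rw [eq_comm, ← neg_neg (∫ x, inner ℝ (G x) h * φ (x - t • h)), ← hu.2.2 _ h3 h4 h,
    ← integral_neg]
  refine integral_congr_ae (Eventually.of_forall fun x => ?_)
  have e1 : fderiv ℝ (fun x => φ (x - t • h)) x = fderiv ℝ φ (x - t • h) :=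
    fderiv_comp_sub _
  have e2 : fderiv ℝ (fun y => φ (-y)) (t • h - x) = - fderiv ℝ φ (x - t • h) := by
    have hd := (h1.differentiable (by simp) (-(t • h - x))).hasFDerivAt.comp (t • h - x)
      (hasFDerivAt_id (t • h - x)).neg
    rw [neg_sub] at hd
    refine hd.fderiv.trans ?_
    ext z
    simp
  simp only [e1, e2, neg_apply, mul_neg]

/-- The translation estimate `‖u(· + h) - u‖₂ ≤ |h| ‖∇u‖₂`. -/
theorem eLpNorm_translate_sub_le (hu : HasWeakGradient u G) (hG : MemLp G 2 volume)
    (h : EuclideanSpace ℝ (Fin n)) :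
    eLpNorm (fun x => u (x + h) - u x) 2 volume ≤
      ENNReal.ofReal (‖h‖ * (eLpNorm G 2 volume).toReal) := by
  refine eLpNorm_two_le_of_forall_integral_le ((hu.1.comp_add_right h).sub hu.1) (by positivity) ?_
  intro φ h1 h2
  have hφ : MemLp φ 2 volume := h1.continuous.memLp_of_hasCompactSupport h2
  have hGh : MemLp (fun x => inner ℝ (G x) h) 2 volume := hG.inner_const h
  have hGn : (eLpNorm (fun x => inner ℝ (G x) h) 2 volume).toReal ≤
      ‖h‖ * (eLpNorm G 2 volume).toReal := by
    have : eLpNorm (fun x => inner ℝ (G x) h) 2 volume ≤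
        ENNReal.ofReal ‖h‖ * eLpNorm G 2 volume :=
      eLpNorm_le_mul_eLpNorm_of_ae_le_mul (Eventually.of_forall fun x => by
        rw [mul_comm]; exact norm_inner_le_norm _ _) 2
    have := ENNReal.toReal_mono (ENNReal.mul_ne_top ENNReal.ofReal_ne_top hG.2.ne) this
    rwa [ENNReal.toReal_mul, ENNReal.toReal_ofReal (norm_nonneg h)] at this
  have hbound : ∀ t : ℝ, ‖∫ x, inner ℝ (G x) h * φ (x - t • h)‖ ≤
      ‖h‖ * (eLpNorm G 2 volume).toReal * (eLpNorm φ 2 volume).toReal := by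
    intro t
    have hmp := measurePreserving_sub_right (volume : Measure (EuclideanSpace ℝ (Fin n))) (t • h)
    have h3 : MemLp (fun x => φ (x - t • h)) 2 volume := hφ.comp_measurePreserving hmp
    have h4 : eLpNorm (fun x => φ (x - t • h)) 2 volume = eLpNorm φ 2 volume :=
      eLpNorm_comp_measurePreserving hφ.1 hmp
    refine (abs_integral_mul_le_eLpNorm_two hGh h3).trans ?_
    rw [h4]
    exact mul_le_mul_of_nonneg_right hGn ENNReal.toReal_nonneg
  -- The pairing of φ with u(· + h) - u is the increment from t = 0 to t = 1 of the integral of u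
  -- times φ(· - t • h). Its derivative is bounded uniformly in t by Cauchy–Schwarz, since
  -- translating φ preserves its norm.
  have hmvt := convex_univ.norm_image_sub_le_of_norm_hasDerivWithin_le (𝕜 := ℝ)
    (fun t _ => (hasDerivAt_integral_mul_translate hu h1 h2 h t).hasDerivWithinAt)
    (fun t _ => hbound t) (Set.mem_univ 0) (Set.mem_univ 1)
  simp only [one_smul, zero_smul, sub_zero, norm_one, mul_one, Real.norm_eq_abs] at hmvt
  refine le_of_eq_of_le ?_ hmvt
  have i1 : Integrable (fun x => φ x * u (x + h)) volume :=
    (hu.1.comp_add_right h).integrable_smul_left_of_hasCompactSupport h1.continuous h2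
  have i2 : Integrable (fun x => φ x * u x) volume :=
    hu.1.integrable_smul_left_of_hasCompactSupport h1.continuous h2
  have e : ∫ x, u x * φ (x - h) = ∫ x, φ x * u (x + h) := by
    rw [← integral_add_right_eq_self (μ := volume) (fun x => u x * φ (x - h)) h]
    simp [mul_comm]
  rw [e]
  simp only [mul_comm (u _)]
  rw [← integral_sub i1 i2]
  simp only [Pi.sub_apply, mul_sub]

theorem eLpNorm_two_sq {α F : Type*} [MeasurableSpace α] [NormedAddCommGroup F] (μ : Measure α)
    (f : α → F) : eLpNorm f 2 μ ^ 2 = ∫⁻ x, ‖f x‖ₑ ^ 2 ∂μ := by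
  have := eLpNorm_nnreal_pow_eq_lintegral (μ := μ) (f := f) (p := 2) two_ne_zero
  simpa using this

theorem measurable_enorm_translate_sub (hm : Measurable u) :
    Measurable (Function.uncurry fun x h => ‖u (x + h) - u x‖ₑ ^ 2) :=
  (((hm.comp (measurable_fst.add measurable_snd)).sub (hm.comp measurable_fst)).enorm).pow_const 2

/-- Tonelli reduces this to the translation estimate for each fixed h, with |h| ≤ r. -/
theorem lintegral_lintegral_translate_sub_le (hm : Measurable u) (hu : HasWeakGradient u G)
    (hG : MemLp G 2 volume) (r : ℝ) :
    ∫⁻ x, ∫⁻ h in Metric.ball 0 r, ‖u (x + h) - u x‖ₑ ^ 2 ≤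
      volume (Metric.ball (0 : EuclideanSpace ℝ (Fin n)) r) *
        (ENNReal.ofReal r * eLpNorm G 2 volume) ^ 2 := by
  rw [lintegral_lintegral_swap (measurable_enorm_translate_sub hm).aemeasurable]
  calc ∫⁻ h in Metric.ball 0 r, ∫⁻ x, ‖u (x + h) - u x‖ₑ ^ 2
      ≤ ∫⁻ _h in Metric.ball (0 : EuclideanSpace ℝ (Fin n)) r,
          (ENNReal.ofReal r * eLpNorm G 2 volume) ^ 2 := by
        refine setLIntegral_mono measurable_const fun h hh => ?_
        rw [← eLpNorm_two_sq]
        gcongr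
        refine (eLpNorm_translate_sub_le hu hG h).trans ?_
        rw [ENNReal.ofReal_mul (norm_nonneg h), ENNReal.ofReal_toReal hG.2.ne]
        gcongr
        exact (mem_ball_zero_iff.1 hh).le
    _ = _ := by rw [setLIntegral_const, mul_comm]

/-- Balls exhaust the space, whose total volume is infinite because its dimension is positive. -/
theorem exists_volume_ball_ge (hn : 1 ≤ n) {M : ENNReal} (hM : M < ⊤) :
    ∃ r : ℝ, 0 ≤ r ∧ M ≤ volume (Metric.ball (0 : EuclideanSpace ℝ (Fin n)) r) := by
  have : Nonempty (Fin n) := ⟨⟨0, hn⟩⟩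
  have hnt : Nontrivial (EuclideanSpace ℝ (Fin n)) := inferInstance
  have hmono : Monotone fun k : ℕ => Metric.ball (0 : EuclideanSpace ℝ (Fin n)) k :=
    fun a b hab => Metric.ball_subset_ball (by exact_mod_cast hab)
  have h := tendsto_measure_iUnion_atTop (μ := volume) hmono
  rw [Metric.iUnion_ball_nat, measure_univ_of_isAddLeftInvariant] at h
  obtain ⟨k, hk⟩ := (h.eventually (lt_mem_nhds hM)).exists
  exact ⟨k, Nat.cast_nonneg k, hk.le⟩

/-- The Poincaré inequality for functions that vanish outside a set of finite measure. -/
theorem exists_poincare_constant (hn : 1 ≤ n) {Ω : Set (EuclideanSpace ℝ (Fin n))}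
    (hΩ : MeasurableSet Ω) (hfin : volume Ω < ⊤) :
    ∃ C : NNReal, ∀ (u : EuclideanSpace ℝ (Fin n) → ℝ)
      (G : EuclideanSpace ℝ (Fin n) → EuclideanSpace ℝ (Fin n)),
      HasWeakGradient u G → MemLp G 2 volume → (∀ᵐ x, x ∉ Ω → u x = 0) →
        eLpNorm u 2 volume ≤ C * eLpNorm G 2 volume := by
  -- With one unit of volume beyond |Ω|, for every x the points h of the ball with x + h ∉ Ω have
  -- measure at least 1. For such h the difference w(x + h) - w(x) is just -w(x).
  obtain ⟨r, hr, hrΩ⟩ := exists_volume_ball_ge hn (M := volume Ω + 1) (by finiteness)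
  set V := volume (Metric.ball (0 : EuclideanSpace ℝ (Fin n)) r) with hV
  have hVfin : V ≠ ⊤ := measure_ball_lt_top.ne
  -- The argument gives ‖u‖² ≤ V (r ‖G‖)²; the bound V ≤ (V + 1)² avoids a square root in the
  -- constant.
  refine ⟨(V + 1).toNNReal * r.toNNReal, fun u G hu hG h0 => ?_⟩
  -- Tonelli needs a measurable representative, and the pointwise argument needs it to vanish
  -- everywhere outside Ω, not only almost everywhere.
  obtain ⟨v, hvm, huv⟩ := hu.1.aestronglyMeasurable
  have huw : u =ᵐ[volume] Ω.indicator v := by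
    filter_upwards [huv, h0] with x h1 h2
    by_cases hx : x ∈ Ω
    · simp [hx, h1]
    · simp [hx, h2 hx]
  set w := Ω.indicator v with hw
  have hwm : Measurable w := hvm.measurable.indicator hΩ
  rw [eLpNorm_congr_ae huw]
  have key : eLpNorm w 2 volume ^ 2 ≤ V * (ENNReal.ofReal r * eLpNorm G 2 volume) ^ 2 := by
    refine le_trans ?_ (lintegral_lintegral_translate_sub_le hwm (hu.congr_ae huw) hG r)
    rw [eLpNorm_two_sq]
    refine lintegral_mono fun x => ?_
    have hΩx : MeasurableSet ((fun h => x + h) ⁻¹' Ω) := hΩ.preimage (measurable_const_add x)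
    calc ‖w x‖ₑ ^ 2
        ≤ ‖w x‖ₑ ^ 2 * volume (Metric.ball 0 r \ ((fun h => x + h) ⁻¹' Ω)) := by
          refine le_mul_of_one_le_right' ?_
          refine le_trans ?_ le_measure_sdiff
          rw [measure_preimage_add]
          exact ENNReal.le_sub_of_add_le_left hfin.ne hrΩ
      _ = ∫⁻ h in Metric.ball 0 r \ ((fun h => x + h) ⁻¹' Ω), ‖w (x + h) - w x‖ₑ ^ 2 := by
          rw [← setLIntegral_const]
          refine setLIntegral_congr_fun (measurableSet_ball.diff hΩx) fun h hh => ?_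
          have : w (x + h) = 0 := Set.indicator_of_notMem (s := Ω) hh.2 _
          simp [this]
      _ ≤ ∫⁻ h in Metric.ball 0 r, ‖w (x + h) - w x‖ₑ ^ 2 :=
          lintegral_mono_set Set.sdiff_subset
  have hsq : eLpNorm w 2 volume ^ 2 ≤
      ((V + 1) * (ENNReal.ofReal r * eLpNorm G 2 volume)) ^ 2 := by
    refine key.trans ?_
    rw [mul_pow (V + 1)]
    gcongr
    exact le_self_add.trans (le_self_pow₀ le_add_self two_ne_zero)
  have := (ENNReal.pow_le_pow_left_iff two_ne_zero).1 hsq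
  rw [ENNReal.coe_mul, ENNReal.coe_toNNReal (by finiteness), mul_assoc]
  exact this

end Translation

end Partition

namespace Partition

/-! ### Rellich compactness on sets of finite measure. -/

section Compactness

theorem enorm_sq_eq_ofReal (x : ℝ) : ‖x‖ₑ ^ 2 = ENNReal.ofReal (x ^ 2) := by
  rw [Real.enorm_eq_ofReal_abs, ← ENNReal.ofReal_pow (abs_nonneg x), sq_abs]

/-- A constant is controlled by its distance to f and the integral of f. Let V be the total mass and
a = ∫ f. Integrating (f - c)² ≥ c² - 2cf gives V c² - 2ca ≤ ∫ (f - c)²; doubling this and using V (c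
- 2a/V)² ≥ 0 for the cross term yields the constants 2 and 4/V. -/
theorem measure_univ_mul_enorm_sq_le {α : Type*} [MeasurableSpace α] {μ : Measure α}
    [IsFiniteMeasure μ] {f : α → ℝ} (hf : MemLp f 2 μ) (hμ : 0 < μ.real Set.univ) (c : ℝ) :
    μ Set.univ * ‖c‖ₑ ^ 2 ≤ 2 * ∫⁻ x, ‖f x - c‖ₑ ^ 2 ∂μ +
      ENNReal.ofReal (4 / μ.real Set.univ) * ‖∫ x, f x ∂μ‖ₑ ^ 2 := by
  have hi : Integrable f μ := hf.integrable one_le_two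
  have hsub : Integrable (fun x => (f x - c) ^ 2) μ := (hf.sub (memLp_const c)).integrable_sq
  have hd : μ.real Set.univ * c ^ 2 - 2 * c * ∫ x, f x ∂μ ≤ ∫ x, (f x - c) ^ 2 ∂μ := by
    have : ∫ x, (c ^ 2 - 2 * c * f x) ∂μ ≤ ∫ x, (f x - c) ^ 2 ∂μ :=
      integral_mono ((integrable_const _).sub (hi.const_mul _)) hsub fun x => by
        dsimp only
        nlinarith [sq_nonneg (f x)]
    rwa [integral_sub (integrable_const _) (hi.const_mul _), integral_const_mul, integral_const,
      smul_eq_mul] at this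
  have hreal : μ.real Set.univ * c ^ 2 ≤ 2 * ∫ x, (f x - c) ^ 2 ∂μ +
      4 / μ.real Set.univ * (∫ x, f x ∂μ) ^ 2 := by
    set V := μ.real Set.univ
    set a := ∫ x, f x ∂μ
    have h1 : V * c ^ 2 - 4 * c * a + 4 / V * a ^ 2 = V * (c - 2 * a / V) ^ 2 := by
      field_simp
      ring
    have h2 : 0 ≤ V * (c - 2 * a / V) ^ 2 := by positivity
    linarith
  have h := ENNReal.ofReal_le_ofReal hreal
  rw [ENNReal.ofReal_mul measureReal_nonneg, ofReal_measureReal,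
    ENNReal.ofReal_add (by positivity) (by positivity), ENNReal.ofReal_mul zero_le_two,
    ENNReal.ofReal_mul (by positivity), ofReal_integral_eq_lintegral_ofReal hsub
      (Eventually.of_forall fun x => sq_nonneg _)] at h
  simpa only [enorm_sq_eq_ofReal, ENNReal.ofReal_ofNat] using h

variable {n : ℕ}

/-- For each x, the preceding inequality is applied to h ↦ w(x + h) on the ball with c = w(x), and
then integrated over Ω. The oscillation term is bounded by the gradient and is small with r; the
other term involves only ball integrals of w. -/
theorem eLpNorm_sq_le_of_setIntegral_ball {w : EuclideanSpace ℝ (Fin n) → ℝ}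
    {G : EuclideanSpace ℝ (Fin n) → EuclideanSpace ℝ (Fin n)} (hm : Measurable w)
    (hw2 : MemLp w 2 volume) (hw : HasWeakGradient w G) (hG : MemLp G 2 volume)
    {Ω : Set (EuclideanSpace ℝ (Fin n))} (hΩ : MeasurableSet Ω) (h0 : ∀ᵐ x, x ∉ Ω → w x = 0)
    {r : ℝ} (hr : 0 < r) :
    eLpNorm w 2 volume ^ 2 ≤ 2 * (ENNReal.ofReal r * eLpNorm G 2 volume) ^ 2 +
      (volume (Metric.ball (0 : EuclideanSpace ℝ (Fin n)) r))⁻¹ *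
        (ENNReal.ofReal (4 / volume.real (Metric.ball (0 : EuclideanSpace ℝ (Fin n)) r)) *
        ∫⁻ x in Ω, ‖∫ h in Metric.ball 0 r, w (x + h)‖ₑ ^ 2) := by
  set B := Metric.ball (0 : EuclideanSpace ℝ (Fin n)) r with hB
  have hV0 : volume B ≠ 0 := (Metric.measure_ball_pos _ _ hr).ne'
  have hVt : volume B ≠ ⊤ := measure_ball_lt_top.ne
  have hVr : 0 < volume.real B := ENNReal.toReal_pos hV0 hVt
  have : IsFiniteMeasure (volume.restrict B) := ⟨by simpa using hVt.lt_top⟩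
  have hsupp : eLpNorm w 2 volume ^ 2 = ∫⁻ x in Ω, ‖w x‖ₑ ^ 2 := by
    rw [eLpNorm_two_sq, ← lintegral_indicator hΩ]
    refine lintegral_congr_ae ?_
    filter_upwards [h0] with x hx
    by_cases h : x ∈ Ω
    · simp [h]
    · simp [h, hx h]
  have hpt : ∀ x, volume B * ‖w x‖ₑ ^ 2 ≤ 2 * (∫⁻ h in B, ‖w (x + h) - w x‖ₑ ^ 2) +
      ENNReal.ofReal (4 / volume.real B) * ‖∫ h in B, w (x + h)‖ₑ ^ 2 := by
    intro x
    have hx : MemLp (fun h => w (x + h)) 2 (volume.restrict B) :=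
      (hw2.comp_measurePreserving (measurePreserving_add_left volume x)).restrict B
    have := measure_univ_mul_enorm_sq_le hx (by simpa using hVr) (w x)
    simpa using this
  have hmD : Measurable fun x => ∫⁻ h in B, ‖w (x + h) - w x‖ₑ ^ 2 :=
    (measurable_enorm_translate_sub hm).lintegral_prod_right
  have hint : volume B * eLpNorm w 2 volume ^ 2 ≤
      2 * (volume B * (ENNReal.ofReal r * eLpNorm G 2 volume) ^ 2) +
      ENNReal.ofReal (4 / volume.real B) * ∫⁻ x in Ω, ‖∫ h in B, w (x + h)‖ₑ ^ 2 := by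
    calc volume B * eLpNorm w 2 volume ^ 2
        = ∫⁻ x in Ω, volume B * ‖w x‖ₑ ^ 2 := by
          rw [hsupp, lintegral_const_mul' _ _ hVt]
      _ ≤ ∫⁻ x in Ω, (2 * (∫⁻ h in B, ‖w (x + h) - w x‖ₑ ^ 2) +
            ENNReal.ofReal (4 / volume.real B) * ‖∫ h in B, w (x + h)‖ₑ ^ 2) :=
          lintegral_mono hpt
      _ = 2 * (∫⁻ x in Ω, ∫⁻ h in B, ‖w (x + h) - w x‖ₑ ^ 2) +
            ENNReal.ofReal (4 / volume.real B) * ∫⁻ x in Ω, ‖∫ h in B, w (x + h)‖ₑ ^ 2 := by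
          rw [lintegral_add_left (hmD.const_mul 2), lintegral_const_mul' _ _ (by simp),
            lintegral_const_mul' _ _ ENNReal.ofReal_ne_top]
      _ ≤ _ := by
          gcongr
          exact (setLIntegral_le_lintegral _ _).trans
            (lintegral_lintegral_translate_sub_le hm hw hG r)
  have := mul_le_mul_right hint (volume B)⁻¹
  rw [← mul_assoc, ENNReal.inv_mul_cancel hV0 hVt, one_mul, mul_add, mul_left_comm,
    ← mul_assoc _ (volume B),
    ENNReal.inv_mul_cancel hV0 hVt, one_mul] at this
  exact this

/-- The gradient part of the previous bound is small uniformly in k once r is small. For that fixed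
r, the ball integrals tend to 0 pointwise and are bounded by a constant (Cauchy–Schwarz and
Poincaré), which is integrable over Ω. -/
theorem tendsto_eLpNorm_of_tendsto_setIntegral_ball_of_measurable (hn : 1 ≤ n)
    {Ω : Set (EuclideanSpace ℝ (Fin n))}
    (hΩ : MeasurableSet Ω) (hfin : volume Ω < ⊤) {w : ℕ → EuclideanSpace ℝ (Fin n) → ℝ}
    {G : ℕ → EuclideanSpace ℝ (Fin n) → EuclideanSpace ℝ (Fin n)} (hm : ∀ k, Measurable (w k))
    (hw : ∀ k, HasWeakGradient (w k) (G k)) (hG : ∀ k, MemLp (G k) 2 volume) {C : NNReal}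
    (hC : ∀ k, eLpNorm (G k) 2 volume ≤ C) (h0 : ∀ k, ∀ᵐ x, x ∉ Ω → w k x = 0)
    (hlim : ∀ x r, Tendsto (fun k => ∫ y in Metric.ball x r, w k y) atTop (𝓝 0)) :
    Tendsto (fun k => eLpNorm (w k) 2 volume) atTop (𝓝 0) := by
  obtain ⟨P, hP⟩ := exists_poincare_constant hn hΩ hfin
  have hwP : ∀ k, eLpNorm (w k) 2 volume ≤ (P * C : NNReal) := fun k => by
    refine (hP _ _ (hw k) (hG k) (h0 k)).trans ?_
    rw [ENNReal.coe_mul]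
    gcongr
    exact hC k
  have hw2 : ∀ k, MemLp (w k) 2 volume := fun k =>
    ⟨(hm k).aestronglyMeasurable, (hwP k).trans_lt ENNReal.coe_lt_top⟩
  have htrans : ∀ (k : ℕ) (x : EuclideanSpace ℝ (Fin n)) (r : ℝ),
      ∫ h in Metric.ball 0 r, w k (x + h) = ∫ y in Metric.ball x r, w k y := by
    intro k x r
    have := (measurePreserving_add_left (volume : Measure (EuclideanSpace ℝ (Fin n))) x)
      |>.setIntegral_preimage_emb (measurableEmbedding_addLeft x) (w k) (Metric.ball x r)
    rw [← this]
    congr 2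
    ext h
    simp
  have hA : ∀ r : ℝ, Tendsto (fun k => ∫⁻ x in Ω, ‖∫ h in Metric.ball 0 r, w k (x + h)‖ₑ ^ 2)
      atTop (𝓝 0) := by
    intro r
    have hb : ∀ k x, ‖∫ h in Metric.ball 0 r, w k (x + h)‖ₑ ^ 2 ≤
        (eLpNorm (fun _ => (1 : ℝ)) 2
          (volume.restrict (Metric.ball (0 : EuclideanSpace ℝ (Fin n)) r)) * (P * C : NNReal)) ^ 2 := by
      intro k x
      have : IsFiniteMeasure (volume.restrict (Metric.ball (0 : EuclideanSpace ℝ (Fin n)) r)) :=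
        ⟨by simpa using measure_ball_lt_top⟩
      gcongr
      have hx : MemLp (fun h => w k (x + h)) 2 volume :=
        (hw2 k).comp_measurePreserving (measurePreserving_add_left volume x)
      have hxe : eLpNorm (fun h => w k (x + h)) 2 volume = eLpNorm (w k) 2 volume :=
        eLpNorm_comp_measurePreserving (hw2 k).1 (measurePreserving_add_left volume x)
      have hone : MemLp (fun _ : EuclideanSpace ℝ (Fin n) => (1 : ℝ)) 2
        (volume.restrict (Metric.ball 0 r)) := memLp_const 1
      have h := abs_integral_mul_le_eLpNorm_two hone (hx.restrict (Metric.ball 0 r))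
      simp only [one_mul] at h
      rw [Real.enorm_eq_ofReal_abs]
      refine (ENNReal.ofReal_le_ofReal h).trans ?_
      rw [ENNReal.ofReal_mul ENNReal.toReal_nonneg, ENNReal.ofReal_toReal hone.2.ne,
        ENNReal.ofReal_toReal (hx.restrict _).2.ne]
      gcongr
      exact (eLpNorm_mono_measure _ Measure.restrict_le_self).trans (hxe.trans_le (hwP k))
    have hmeas : ∀ k, Measurable fun x => ‖∫ h in Metric.ball 0 r, w k (x + h)‖ₑ ^ 2 := by
      intro k
      have h1 : StronglyMeasurable (Function.uncurry fun x h => w k (x + h)) :=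
        ((hm k).comp (measurable_fst.add measurable_snd)).stronglyMeasurable
      exact (h1.integral_prod_right
        (ν := volume.restrict (Metric.ball 0 r))).measurable.enorm.pow_const 2
    have hzero : Tendsto (fun k => ∫⁻ x in Ω, ‖∫ h in Metric.ball 0 r, w k (x + h)‖ₑ ^ 2)
        atTop (𝓝 (∫⁻ _x in Ω, 0)) := by
      refine tendsto_lintegral_of_dominated_convergence _ hmeas
        (fun k => Eventually.of_forall (hb k)) ?_ (Eventually.of_forall fun x => ?_)
      · rw [setLIntegral_const]
        have : IsFiniteMeasure (volume.restrict (Metric.ball (0 : EuclideanSpace ℝ (Fin n)) r)) :=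
          ⟨by simpa using measure_ball_lt_top⟩
        have h1 := (memLp_const (1 : ℝ) (p := 2)
          (μ := volume.restrict (Metric.ball (0 : EuclideanSpace ℝ (Fin n)) r))).2.ne
        exact ENNReal.mul_ne_top (ENNReal.pow_ne_top (ENNReal.mul_ne_top h1 ENNReal.coe_ne_top))
          hfin.ne
      · have h1 := hlim x r
        simp only [← htrans] at h1
        have h2 := (((ENNReal.continuous_pow 2).comp continuous_enorm).tendsto (0 : ℝ)).comp h1
        simpa [Function.comp_def] using h2
    simpa using hzero
  have hsq : Tendsto (fun k => eLpNorm (w k) 2 volume ^ 2) atTop (𝓝 0) := by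
    rw [ENNReal.tendsto_nhds_zero]
    intro ε hε
    -- The radius is fixed first, from the uniform gradient bound alone; only then does k go to
    -- infinity.
    have hcont : Tendsto (fun r : ℝ => 2 * (ENNReal.ofReal r * (C : ENNReal)) ^ 2)
        (𝓝[>] 0) (𝓝 0) := by
      have : Continuous fun r : ℝ => 2 * ((ENNReal.ofReal r * (C : ENNReal)) ^ 2) := by
        refine (ENNReal.continuous_const_mul (by simp)).comp
          ((ENNReal.continuous_pow 2).comp ((ENNReal.continuous_mul_const ENNReal.coe_ne_top).comp
            ENNReal.continuous_ofReal))
      simpa using (this.tendsto 0).mono_left nhdsWithin_le_nhds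
    obtain ⟨r, hr, hr0⟩ := ((ENNReal.tendsto_nhds_zero.1 hcont (ε / 2) (ENNReal.half_pos hε.ne')).and
      self_mem_nhdsWithin).exists
    have hV0 : volume (Metric.ball (0 : EuclideanSpace ℝ (Fin n)) r) ≠ 0 :=
      (Metric.measure_ball_pos _ _ hr0).ne'
    have hlim2 : Tendsto (fun k => (volume (Metric.ball (0 : EuclideanSpace ℝ (Fin n)) r))⁻¹ *
        (ENNReal.ofReal (4 / volume.real (Metric.ball (0 : EuclideanSpace ℝ (Fin n)) r)) *
        ∫⁻ x in Ω, ‖∫ h in Metric.ball 0 r, w k (x + h)‖ₑ ^ 2)) atTop (𝓝 0) := by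
      have := ENNReal.Tendsto.const_mul (a := (volume (Metric.ball (0 : EuclideanSpace ℝ (Fin n)) r))⁻¹)
        (ENNReal.Tendsto.const_mul (a := ENNReal.ofReal (4 / volume.real
          (Metric.ball (0 : EuclideanSpace ℝ (Fin n)) r))) (hA r) (Or.inr ENNReal.ofReal_ne_top))
        (Or.inr (ENNReal.inv_ne_top.2 hV0))
      simpa using this
    filter_upwards [ENNReal.tendsto_nhds_zero.1 hlim2 (ε / 2) (ENNReal.half_pos hε.ne')] with k hk
    refine (eLpNorm_sq_le_of_setIntegral_ball (hm k) (hw2 k) (hw k) (hG k) hΩ (h0 k) hr0).trans ?_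
    rw [← ENNReal.add_halves ε]
    refine add_le_add (le_trans ?_ hr) hk
    gcongr
    exact hC k
  have hroot := (ENNReal.continuous_rpow_const (y := (1 / 2 : ℝ))).tendsto 0 |>.comp hsq
  rw [ENNReal.zero_rpow_of_pos (by norm_num)] at hroot
  refine hroot.congr fun k => ?_
  rw [Function.comp_apply, ← ENNReal.rpow_natCast, ← ENNReal.rpow_mul]
  norm_num

/-- Rellich compactness on a set of finite measure: functions vanishing outside such a set, with
gradients bounded in `L²` and averages on balls tending to `0`, tend to `0` in `L²`. -/
theorem tendsto_eLpNorm_of_tendsto_setIntegral_ball (hn : 1 ≤ n)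
    {Ω : Set (EuclideanSpace ℝ (Fin n))}
    (hΩ : MeasurableSet Ω) (hfin : volume Ω < ⊤) {w : ℕ → EuclideanSpace ℝ (Fin n) → ℝ}
    {G : ℕ → EuclideanSpace ℝ (Fin n) → EuclideanSpace ℝ (Fin n)}
    (hw : ∀ k, HasWeakGradient (w k) (G k)) (hG : ∀ k, MemLp (G k) 2 volume) {C : NNReal}
    (hC : ∀ k, eLpNorm (G k) 2 volume ≤ C) (h0 : ∀ k, ∀ᵐ x, x ∉ Ω → w k x = 0)
    (hlim : ∀ x r, Tendsto (fun k => ∫ y in Metric.ball x r, w k y) atTop (𝓝 0)) :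
    Tendsto (fun k => eLpNorm (w k) 2 volume) atTop (𝓝 0) := by
  choose v hv hwv using fun k => (hw k).1.aestronglyMeasurable
  have h := tendsto_eLpNorm_of_tendsto_setIntegral_ball_of_measurable hn hΩ hfin
    (fun k => (hv k).measurable) (fun k => (hw k).congr_ae (hwv k)) hG hC
    (fun k => by
      filter_upwards [h0 k, hwv k] with x h1 h2 hx
      rw [← h2, h1 hx])
    (fun x r => (hlim x r).congr fun k => integral_congr_ae (ae_restrict_of_ae (hwv k)))
  exact h.congr fun k => (eLpNorm_congr_ae (hwv k)).symm

end Compactness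

end Partition

namespace Partition

/-! ### Weak limits and the energy of one component. -/

section Components

variable {n : ℕ} {u v : EuclideanSpace ℝ (Fin n) → ℝ}
  {G H : EuclideanSpace ℝ (Fin n) → EuclideanSpace ℝ (Fin n)}
  {Ω : Set (EuclideanSpace ℝ (Fin n))} {f g : EuclideanSpace ℝ (Fin n) → ℝ}

theorem inner_toLp_toLp {α F : Type*} [MeasurableSpace α] {μ : Measure α} [NormedAddCommGroup F]
    [InnerProductSpace ℝ F] {a b : α → F} (ha : MemLp a 2 μ) (hb : MemLp b 2 μ) :
    inner ℝ (ha.toLp a) (hb.toLp b) = ∫ x, inner ℝ (a x) (b x) ∂μ := by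
  rw [L2.inner_def]
  refine integral_congr_ae ?_
  filter_upwards [ha.coeFn_toLp, hb.coeFn_toLp] with x h1 h2
  rw [h1, h2]

theorem norm_toLp_sq {α F : Type*} [MeasurableSpace α] {μ : Measure α} [NormedAddCommGroup F]
    [InnerProductSpace ℝ F] {a : α → F} (ha : MemLp a 2 μ) :
    ‖ha.toLp a‖ ^ 2 = ∫ x, ‖a x‖ ^ 2 ∂μ := by
  rw [← real_inner_self_eq_norm_sq, inner_toLp_toLp]
  simp only [real_inner_self_eq_norm_sq]

theorem integrable_norm_sq {α F : Type*} [MeasurableSpace α] {μ : Measure α}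
    [NormedAddCommGroup F] {a : α → F} (ha : MemLp a 2 μ) :
    Integrable (fun x => ‖a x‖ ^ 2) μ :=
  ha.norm.integrable_sq

theorem hasWeakGradient_weakGradient (h : ∃ G, HasWeakGradient u G) :
    HasWeakGradient u (weakGradient u) := by
  rw [weakGradient, dif_pos h]
  exact h.choose_spec

theorem MemW12.hasWeakGradient (h : MemW12 u) : HasWeakGradient u (weakGradient u) :=
  hasWeakGradient_weakGradient ⟨_, h.2.choose_spec.1⟩

theorem MemW12.memLp_weakGradient (h : MemW12 u) : MemLp (weakGradient u) 2 volume := by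
  obtain ⟨G, hG, hG2⟩ := h.2
  exact hG2.ae_eq (hG.ae_eq h.hasWeakGradient)

theorem HasWeakGradient.sub (hu : HasWeakGradient u G) (hv : HasWeakGradient v H) :
    HasWeakGradient (fun x => u x - v x) (fun x => G x - H x) := by
  refine ⟨hu.1.sub hv.1, hu.2.1.sub hv.2.1, fun φ h1 h2 z => ?_⟩
  have hc : Continuous fun x => fderiv ℝ φ x z :=
    (h1.continuous_fderiv (by simp)).clm_apply continuous_const
  have hs : HasCompactSupport fun x => fderiv ℝ φ x z := h2.fderiv_apply ℝ z
  have i1 : ∀ w : EuclideanSpace ℝ (Fin n) → ℝ, LocallyIntegrable w volume →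
      Integrable (fun x => w x * fderiv ℝ φ x z) := fun w hw =>
    (hw.integrable_smul_left_of_hasCompactSupport hc hs).congr
      (Eventually.of_forall fun x => mul_comm _ _)
  have i2 : ∀ K : EuclideanSpace ℝ (Fin n) → EuclideanSpace ℝ (Fin n), LocallyIntegrable K volume →
      Integrable (fun x => inner ℝ (K x) z * φ x) := fun K hK =>
    ((hK.integrable_smul_left_of_hasCompactSupport h1.continuous h2).inner_const z).congr
      (Eventually.of_forall fun x => by simp [real_inner_smul_left, mul_comm])
  simp only [sub_mul, inner_sub_left]
  rw [integral_sub (i1 u hu.1) (i1 v hv.1), integral_sub (i2 G hu.2.1) (i2 H hv.2.1),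
    hu.2.2 φ h1 h2 z, hv.2.2 φ h1 h2 z]
  ring

/-- The weak gradient has a weakly closed graph in `L² × L²`. -/
theorem hasWeakGradient_of_tendsto_inner
    {a : ℕ → Lp ℝ 2 (volume : Measure (EuclideanSpace ℝ (Fin n)))}
    {b : ℕ → Lp (EuclideanSpace ℝ (Fin n)) 2 (volume : Measure (EuclideanSpace ℝ (Fin n)))}
    (h : ∀ k, HasWeakGradient (a k) (b k))
    {a' : Lp ℝ 2 (volume : Measure (EuclideanSpace ℝ (Fin n)))}
    {b' : Lp (EuclideanSpace ℝ (Fin n)) 2 (volume : Measure (EuclideanSpace ℝ (Fin n)))}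
    (ha : ∀ q, Tendsto (fun k => inner ℝ (a k) q) atTop (𝓝 (inner ℝ a' q)))
    (hb : ∀ q, Tendsto (fun k => inner ℝ (b k) q) atTop (𝓝 (inner ℝ b' q))) :
    HasWeakGradient a' b' := by
  refine ⟨(Lp.memLp a').locallyIntegrable one_le_two, (Lp.memLp b').locallyIntegrable one_le_two,
    fun φ h1 h2 z => ?_⟩
  have hc : Continuous fun x => fderiv ℝ φ x z :=
    (h1.continuous_fderiv (by simp)).clm_apply continuous_const
  have hs : HasCompactSupport fun x => fderiv ℝ φ x z := h2.fderiv_apply ℝ z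
  -- Both sides of the defining identity are L² inner products with fixed vectors, ∂_z φ and φ z, so
  -- each passes to the weak limit.
  have m1 : MemLp (fun x => fderiv ℝ φ x z) 2 volume := hc.memLp_of_hasCompactSupport hs
  have m2 : MemLp (fun x => φ x • z) 2 volume :=
    (h1.continuous.smul continuous_const).memLp_of_hasCompactSupport
      (h2.smul_right (f' := fun _ => z))
  have e1 : ∀ c : Lp ℝ 2 (volume : Measure (EuclideanSpace ℝ (Fin n))),
      inner ℝ c (m1.toLp _) = ∫ x, c x * fderiv ℝ φ x z := by
    intro c
    rw [L2.inner_def]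
    refine integral_congr_ae ?_
    filter_upwards [m1.coeFn_toLp] with x hx
    simp [hx, mul_comm]
  have e2 : ∀ c : Lp (EuclideanSpace ℝ (Fin n)) 2 (volume : Measure (EuclideanSpace ℝ (Fin n))),
      inner ℝ c (m2.toLp _) = ∫ x, inner ℝ (c x) z * φ x := by
    intro c
    rw [L2.inner_def]
    refine integral_congr_ae ?_
    filter_upwards [m2.coeFn_toLp] with x hx
    simp [hx, real_inner_smul_right, mul_comm]
  have t1 := ha (m1.toLp _)
  have t2 := (hb (m2.toLp _)).neg
  simp only [e1] at t1
  simp only [e2] at t2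
  exact tendsto_nhds_unique t1 (t2.congr fun k => ((h k).2.2 φ h1 h2 z).symm)

/-- Testing the weak convergence against the restriction of the limit to the complement of Ω shows
that this restriction has norm zero. -/
theorem ae_eq_zero_of_tendsto_inner (hΩ : MeasurableSet Ω)
    {a : ℕ → Lp ℝ 2 (volume : Measure (EuclideanSpace ℝ (Fin n)))}
    (h : ∀ k, ∀ᵐ x, x ∉ Ω → a k x = 0)
    {a' : Lp ℝ 2 (volume : Measure (EuclideanSpace ℝ (Fin n)))}
    (ha : ∀ q, Tendsto (fun k => inner ℝ (a k) q) atTop (𝓝 (inner ℝ a' q))) :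
    ∀ᵐ x, x ∉ Ω → a' x = 0 := by
  have m : MemLp (Ωᶜ.indicator a') 2 volume := (Lp.memLp a').indicator hΩ.compl
  have t := ha (m.toLp _)
  have hz : ∀ k, inner ℝ (a k) (m.toLp _) = 0 := by
    intro k
    rw [L2.inner_def]
    refine integral_eq_zero_of_ae ?_
    filter_upwards [m.coeFn_toLp, h k] with x h1 h2
    by_cases hx : x ∈ Ω
    · simp [h1, hx]
    · simp [h2 hx]
  simp only [hz] at t
  have h0 : inner ℝ a' (m.toLp _) = 0 := (tendsto_nhds_unique t tendsto_const_nhds)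
  have hself : inner ℝ a' (m.toLp _) = ‖m.toLp _‖ ^ 2 := by
    rw [← real_inner_self_eq_norm_sq, L2.inner_def, L2.inner_def]
    refine integral_congr_ae ?_
    filter_upwards [m.coeFn_toLp] with x h1
    by_cases hx : x ∈ Ω
    · simp [h1, hx]
    · simp [h1, hx]
  rw [hself, sq_eq_zero_iff, norm_eq_zero] at h0
  have := m.coeFn_toLp
  rw [h0] at this
  filter_upwards [this, Lp.coeFn_zero ℝ 2 (volume : Measure (EuclideanSpace ℝ (Fin n)))]
    with x h1 h2 hx
  rw [h1] at h2
  simpa [hx] using h2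

/-- Rellich's theorem: weak convergence of functions vanishing outside a set of finite measure and
of their gradients implies strong convergence of the functions. -/
theorem tendsto_eLpNorm_sub_of_tendsto_inner (hn : 1 ≤ n) (hΩ : MeasurableSet Ω)
    (hfin : volume Ω < ⊤)
    {a : ℕ → Lp ℝ 2 (volume : Measure (EuclideanSpace ℝ (Fin n)))}
    {b : ℕ → Lp (EuclideanSpace ℝ (Fin n)) 2 (volume : Measure (EuclideanSpace ℝ (Fin n)))}
    (h : ∀ k, HasWeakGradient (a k) (b k)) {C : ℝ} (hC : ∀ k, ‖b k‖ ≤ C)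
    (h0 : ∀ k, ∀ᵐ x, x ∉ Ω → a k x = 0)
    {a' : Lp ℝ 2 (volume : Measure (EuclideanSpace ℝ (Fin n)))}
    {b' : Lp (EuclideanSpace ℝ (Fin n)) 2 (volume : Measure (EuclideanSpace ℝ (Fin n)))}
    (ha : ∀ q, Tendsto (fun k => inner ℝ (a k) q) atTop (𝓝 (inner ℝ a' q)))
    (hb : ∀ q, Tendsto (fun k => inner ℝ (b k) q) atTop (𝓝 (inner ℝ b' q))) :
    Tendsto (fun k => eLpNorm (fun x => a k x - a' x) 2 volume) atTop (𝓝 0) := by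
  have h' := hasWeakGradient_of_tendsto_inner h ha hb
  have h0' := ae_eq_zero_of_tendsto_inner hΩ h0 ha
  refine tendsto_eLpNorm_of_tendsto_setIntegral_ball hn hΩ hfin (fun k => (h k).sub h')
    (fun k => (Lp.memLp (b k)).sub (Lp.memLp b')) (C := (C + ‖b'‖).toNNReal) (fun k => ?_)
    (fun k => ?_) (fun x r => ?_)
  · have e : eLpNorm (fun x => b k x - b' x) 2 volume = eLpNorm (b k - b' : Lp _ 2 volume) 2 volume :=
      eLpNorm_congr_ae (Lp.coeFn_sub (b k) b').symm
    rw [e, ← Lp.enorm_def, ← ofReal_norm]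
    exact ENNReal.ofReal_le_ofReal ((norm_sub_le _ _).trans (by linarith [hC k]))
  · filter_upwards [h0 k, h0'] with x h1 h2 hx
    rw [h1 hx, h2 hx, sub_zero]
  -- Ball integrals are inner products with indicators of balls, so weak convergence sends those of
  -- the differences to 0.
  · have hB : volume (Metric.ball x r) ≠ ⊤ := measure_ball_lt_top.ne
    have e : ∀ c : Lp ℝ 2 (volume : Measure (EuclideanSpace ℝ (Fin n))),
        inner ℝ c (indicatorConstLp 2 measurableSet_ball hB (1 : ℝ)) =
          ∫ y in Metric.ball x r, c y := by
      intro c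
      rw [real_inner_comm, L2.inner_indicatorConstLp_one]
    have hi : ∀ c : Lp ℝ 2 (volume : Measure (EuclideanSpace ℝ (Fin n))),
        IntegrableOn c (Metric.ball x r) volume := fun c =>
      (((Lp.memLp c).locallyIntegrable one_le_two).integrableOn_isCompact
        (isCompact_closedBall x r)).mono_set Metric.ball_subset_closedBall
    have t := (ha (indicatorConstLp 2 measurableSet_ball hB (1 : ℝ))).sub_const
      (inner ℝ a' (indicatorConstLp 2 measurableSet_ball hB (1 : ℝ)))
    rw [sub_self] at t
    refine t.congr fun k => ?_
    rw [e, e, integral_sub (hi _) (hi _)]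

/-- The part of the functional that depends on a single component. -/
noncomputable def componentEnergy (Ω : Set (EuclideanSpace ℝ (Fin n)))
    (f g u : EuclideanSpace ℝ (Fin n) → ℝ) : ℝ :=
  (∫ x, ‖weakGradient u x‖ ^ 2) + ∫ x in Ω, (u x ^ 2 * f x - u x * g x)

theorem memLp_mul_of_memLp_top {α : Type*} [MeasurableSpace α] {μ : Measure α} {a b : α → ℝ}
    (ha : MemLp a 2 μ) (hb : MemLp b ⊤ μ) : MemLp (fun x => a x * b x) 2 μ :=
  hb.mul ha

theorem integrable_mul_of_memLp_two {α : Type*} [MeasurableSpace α] {μ : Measure α} {a b : α → ℝ}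
    (ha : MemLp a 2 μ) (hb : MemLp b 2 μ) : Integrable (fun x => a x * b x) μ :=
  ha.integrable_mul hb

theorem integrable_sq_mul {α : Type*} [MeasurableSpace α] {μ : Measure α} {a b : α → ℝ}
    (ha : MemLp a 2 μ) (hb : MemLp b ⊤ μ) : Integrable (fun x => a x ^ 2 * b x) μ := by
  refine (integrable_mul_of_memLp_two ha (memLp_mul_of_memLp_top ha hb)).congr
    (Eventually.of_forall fun x => ?_)
  dsimp only
  ring

/-- The term with f is nonnegative and is dropped. With y = ‖∇u‖₂ and c = ‖g‖₂, Poincaré bounds the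
linear term by P c y, and y² - P c y ≥ y²/2 - (P c)²/2. -/
theorem exists_componentEnergy_ge (hn : 1 ≤ n) (hΩ : MeasurableSet Ω) (hfin : volume Ω < ⊤)
    (hf : MemLp f ⊤ (volume.restrict Ω)) (hf0 : ∀ᵐ x ∂(volume.restrict Ω), 0 ≤ f x)
    (hg : MemLp g 2 (volume.restrict Ω)) :
    ∃ K : ℝ, 0 ≤ K ∧ ∀ u, MemW12 u → (∀ᵐ x, x ∉ Ω → u x = 0) →
      (eLpNorm (weakGradient u) 2 volume).toReal ^ 2 / 2 - K ≤ componentEnergy Ω f g u := by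
  obtain ⟨P, hP⟩ := exists_poincare_constant hn hΩ hfin
  set c := (eLpNorm g 2 (volume.restrict Ω)).toReal
  refine ⟨(P * c) ^ 2 / 2, by positivity, fun u hu h0 => ?_⟩
  have hG := hu.memLp_weakGradient
  have hle := hP u _ hu.hasWeakGradient hG h0
  set y := (eLpNorm (weakGradient u) 2 volume).toReal with hy
  have hu2 : MemLp u 2 volume := ⟨hu.hasWeakGradient.1.aestronglyMeasurable,
    hle.trans_lt (ENNReal.mul_lt_top ENNReal.coe_lt_top hG.2)⟩
  have huy : (eLpNorm u 2 (volume.restrict Ω)).toReal ≤ P * y := by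
    have := ENNReal.toReal_mono (ENNReal.mul_ne_top ENNReal.coe_ne_top hG.2.ne)
      ((eLpNorm_mono_measure u (Measure.restrict_le_self (s := Ω))).trans hle)
    simpa [hy] using this
  have e1 : ∫ x, ‖weakGradient u x‖ ^ 2 = y ^ 2 := by
    rw [← norm_toLp_sq hG, Lp.norm_toLp]
  have hur := hu2.restrict Ω
  have e2 : -(P * y * c) ≤ ∫ x in Ω, (u x ^ 2 * f x - u x * g x) := by
    rw [integral_sub (integrable_sq_mul hur hf) (integrable_mul_of_memLp_two hur hg)]
    have h1 : 0 ≤ ∫ x in Ω, u x ^ 2 * f x := integral_nonneg_of_ae (by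
      filter_upwards [hf0] with x hx
      exact mul_nonneg (sq_nonneg _) hx)
    have h2 := (abs_integral_mul_le_eLpNorm_two hur hg).trans
      (mul_le_mul_of_nonneg_right huy ENNReal.toReal_nonneg)
    linarith [(abs_le.1 h2).2]
  rw [componentEnergy, e1]
  nlinarith [sq_nonneg (y - P * c)]

/-- The energy of a component lies above its tangent at any given function. -/
theorem exists_componentEnergy_add_inner_le (hΩ : MeasurableSet Ω)
    (hf : MemLp f ⊤ (volume.restrict Ω)) (hf0 : ∀ᵐ x ∂(volume.restrict Ω), 0 ≤ f x)
    (hg : MemLp g 2 (volume.restrict Ω)) {v : EuclideanSpace ℝ (Fin n) → ℝ}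
    (hv : MemLp v 2 volume) (hH : MemLp (weakGradient v) 2 volume) :
    ∃ (Q : Lp ℝ 2 (volume : Measure (EuclideanSpace ℝ (Fin n))))
      (R : Lp (EuclideanSpace ℝ (Fin n)) 2 (volume : Measure (EuclideanSpace ℝ (Fin n)))),
      ∀ (u : EuclideanSpace ℝ (Fin n) → ℝ) (hu : MemLp u 2 volume)
        (hG : MemLp (weakGradient u) 2 volume),
        componentEnergy Ω f g v + (inner ℝ (hu.toLp u) Q - inner ℝ (hv.toLp v) Q) +
          (inner ℝ (hG.toLp (weakGradient u)) R - inner ℝ (hH.toLp (weakGradient v)) R) ≤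
        componentEnergy Ω f g u := by
  have hvr := hv.restrict Ω
  have hq : MemLp (fun x => 2 * (v x * f x) - g x) 2 (volume.restrict Ω) :=
    ((memLp_mul_of_memLp_top hvr hf).const_mul 2).sub hg
  have hq' : MemLp (Ω.indicator fun x => 2 * (v x * f x) - g x) 2 volume :=
    (memLp_indicator_iff_restrict hΩ).2 hq
  -- Half of this pair is the usual Euler–Lagrange data: Q = 2vf - g on Ω, extended by zero, and R =
  -- 2∇v are the derivatives of the mass and Dirichlet terms at v. The errors of the tangents are
  -- |∇u - ∇v|² and f (u - v)², nonnegative because f ≥ 0.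
  refine ⟨hq'.toLp _, (2 : ℝ) • hH.toLp (weakGradient v), fun u hu hG => ?_⟩
  have hur := hu.restrict Ω
  have hin : ∀ {w : EuclideanSpace ℝ (Fin n) → ℝ} (hw : MemLp w 2 volume),
      inner ℝ (hw.toLp w) (hq'.toLp _) = ∫ x in Ω, w x * (2 * (v x * f x) - g x) := by
    intro w hw
    rw [inner_toLp_toLp, ← integral_indicator hΩ]
    refine integral_congr_ae (Eventually.of_forall fun x => ?_)
    by_cases hx : x ∈ Ω <;> simp [hx, mul_comm]
  have hgrad : ‖hH.toLp (weakGradient v)‖ ^ 2 +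
      (inner ℝ (hG.toLp (weakGradient u)) ((2 : ℝ) • hH.toLp (weakGradient v)) -
        inner ℝ (hH.toLp (weakGradient v)) ((2 : ℝ) • hH.toLp (weakGradient v))) ≤
      ‖hG.toLp (weakGradient u)‖ ^ 2 := by
    have := norm_sub_sq_real (hG.toLp (weakGradient u)) (hH.toLp (weakGradient v))
    rw [real_inner_smul_right, real_inner_smul_right, real_inner_self_eq_norm_sq]
    nlinarith [sq_nonneg ‖hG.toLp (weakGradient u) - hH.toLp (weakGradient v)‖]
  have hmass : (∫ x in Ω, (v x ^ 2 * f x - v x * g x)) +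
      ((∫ x in Ω, u x * (2 * (v x * f x) - g x)) - ∫ x in Ω, v x * (2 * (v x * f x) - g x)) ≤
      ∫ x in Ω, (u x ^ 2 * f x - u x * g x) := by
    have i1 := integrable_mul_of_memLp_two hur hq
    have i2 := integrable_mul_of_memLp_two hvr hq
    have i3 : Integrable (fun x => v x ^ 2 * f x - v x * g x) (volume.restrict Ω) :=
      (integrable_sq_mul hvr hf).sub (integrable_mul_of_memLp_two hvr hg)
    have i4 : Integrable (fun x => u x ^ 2 * f x - u x * g x) (volume.restrict Ω) :=
      (integrable_sq_mul hur hf).sub (integrable_mul_of_memLp_two hur hg)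
    have i5 : Integrable (fun x => u x * (2 * (v x * f x) - g x) -
      v x * (2 * (v x * f x) - g x)) (volume.restrict Ω) := i1.sub i2
    rw [← integral_sub i1 i2, ← integral_add i3 i5]
    refine integral_mono_ae (i3.add i5) i4 ?_
    filter_upwards [hf0] with x hx
    nlinarith [mul_nonneg hx (sq_nonneg (u x - v x))]
  rw [hin, hin, componentEnergy, componentEnergy, ← norm_toLp_sq hG, ← norm_toLp_sq hH]
  linarith

end Components

end Partition

namespace Partition

/-! ### The direct method. -/

section Minimization

variable {n N : ℕ} {Ω : Set (EuclideanSpace ℝ (Fin n))}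
  {f g : Fin N → EuclideanSpace ℝ (Fin n) → ℝ}

theorem functionalJ_eq (Ω : Set (EuclideanSpace ℝ (Fin n)))
    (f g : Fin N → EuclideanSpace ℝ (Fin n) → ℝ)
    (F : (Fin N → Set (EuclideanSpace ℝ (Fin n))) → ℝ)
    (p : (Fin N → EuclideanSpace ℝ (Fin n) → ℝ) × (Fin N → Set (EuclideanSpace ℝ (Fin n)))) :
    functionalJ Ω f g F p = ∑ i, componentEnergy Ω (f i) (g i) (p.1 i) + F p.2 := by
  simp only [functionalJ, energy, massTerm, componentEnergy, Finset.sum_add_distrib]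

theorem ae_eq_zero_of_mem_admissiblePairs
    {p : (Fin N → EuclideanSpace ℝ (Fin n) → ℝ) × (Fin N → Set (EuclideanSpace ℝ (Fin n)))}
    (hp : p ∈ admissiblePairs N Ω) (i : Fin N) : ∀ᵐ x, x ∉ p.2 i → p.1 i x = 0 := by
  have := hp.2.2 i
  rwa [ae_restrict_iff' (hp.1.1 i).compl] at this

theorem ae_eq_zero_off_of_mem_admissiblePairs
    {p : (Fin N → EuclideanSpace ℝ (Fin n) → ℝ) × (Fin N → Set (EuclideanSpace ℝ (Fin n)))}
    (hp : p ∈ admissiblePairs N Ω) (i : Fin N) : ∀ᵐ x, x ∉ Ω → p.1 i x = 0 := by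
  filter_upwards [ae_eq_zero_of_mem_admissiblePairs hp i] with x hx h
  exact hx fun h' => h (hp.1.2.1 i h')

/-- `MemW12` gives only local square integrability; Poincaré makes it global, since u vanishes
outside Ω. -/
theorem memLp_of_mem_admissiblePairs (hn : 1 ≤ n) (hΩ : MeasurableSet Ω) (hfin : volume Ω < ⊤)
    {p : (Fin N → EuclideanSpace ℝ (Fin n) → ℝ) × (Fin N → Set (EuclideanSpace ℝ (Fin n)))}
    (hp : p ∈ admissiblePairs N Ω) (i : Fin N) : MemLp (p.1 i) 2 volume := by
  obtain ⟨P, hP⟩ := exists_poincare_constant hn hΩ hfin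
  have hu := hp.2.1 i
  exact ⟨hu.hasWeakGradient.1.aestronglyMeasurable,
    (hP _ _ hu.hasWeakGradient hu.memLp_weakGradient
      (ae_eq_zero_off_of_mem_admissiblePairs hp i)).trans_lt
      (ENNReal.mul_lt_top ENNReal.coe_lt_top hu.memLp_weakGradient.2)⟩

theorem empty_mem_disjointTuples : (fun _ => ∅) ∈ disjointTuples N Ω :=
  ⟨fun _ => MeasurableSet.empty, fun _ => Set.empty_subset _, fun _ _ _ => disjoint_bot_left⟩

theorem memW12_zero : MemW12 (0 : EuclideanSpace ℝ (Fin n) → ℝ) :=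
  ⟨fun _ _ => MemLp.zero, 0, ⟨locallyIntegrable_zero, locallyIntegrable_zero, by simp⟩, MemLp.zero⟩

theorem zero_mem_admissiblePairs : ((fun _ => 0, fun _ => ∅) :
    (Fin N → EuclideanSpace ℝ (Fin n) → ℝ) × (Fin N → Set (EuclideanSpace ℝ (Fin n)))) ∈
      admissiblePairs N Ω :=
  ⟨empty_mem_disjointTuples, fun _ => memW12_zero, fun _ => by simp⟩

/-- From almost everywhere convergence of functions supported on disjoint sets, one obtains disjoint
supports of the limits, which are asymptotically covered by the original sets. -/
theorem exists_disjointTuples_of_ae_tendsto (hΩ : MeasurableSet Ω) (hfin : volume Ω < ⊤)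
    {p : ℕ → (Fin N → EuclideanSpace ℝ (Fin n) → ℝ) × (Fin N → Set (EuclideanSpace ℝ (Fin n)))}
    (hp : ∀ k, p k ∈ admissiblePairs N Ω) {a : Fin N → EuclideanSpace ℝ (Fin n) → ℝ}
    (hm : ∀ i, Measurable (a i)) (h0 : ∀ i, ∀ᵐ x, x ∉ Ω → a i x = 0)
    (hlim : ∀ᵐ x, ∀ i, Tendsto (fun k => (p k).1 i x) atTop (𝓝 (a i x))) :
    ∃ S ∈ disjointTuples N Ω, (∀ i, ∀ᵐ x, x ∉ S i → a i x = 0) ∧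
      ∀ i, Tendsto (fun k => volume (S i \ (p k).2 i)) atTop (𝓝 0) := by
  have hsupp : ∀ᵐ x, ∀ k i, x ∉ (p k).2 i → (p k).1 i x = 0 :=
    ae_all_iff.2 fun k => ae_all_iff.2 fun i => ae_eq_zero_of_mem_admissiblePairs (hp k) i
  have hne : ∀ i, MeasurableSet {x | a i x ≠ 0} := fun i =>
    (measurableSet_eq_fun (hm i) measurable_const).compl
  -- Where the limit is nonzero the approximants are eventually nonzero, so the point eventually
  -- belongs to their sets.
  have hmem : ∀ᵐ x, ∀ i, a i x ≠ 0 → ∀ᶠ k in atTop, x ∈ (p k).2 i := by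
    filter_upwards [hsupp, hlim] with x h1 h2 i hi
    filter_upwards [(h2 i).eventually_ne hi] with k hk
    by_contra hx
    exact hk (h1 k i hx)
  -- Removing the other supports makes the sets disjoint everywhere. Only a null set is lost: a
  -- typical point in two supports would lie in two disjoint sets of the same tuple for large k.
  refine ⟨fun i => (Ω ∩ {x | a i x ≠ 0}) \ ⋃ j, ⋃ _ : j ≠ i, {x | a j x ≠ 0}, ⟨fun i => ?_,
    fun i => Set.sdiff_subset.trans Set.inter_subset_left, fun i j hij => ?_⟩, fun i => ?_, fun i => ?_⟩
  · exact (hΩ.inter (hne i)).diff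
      (MeasurableSet.iUnion fun j => MeasurableSet.iUnion fun _ => hne j)
  · refine Set.disjoint_left.2 ?_
    rintro x ⟨⟨-, hx⟩, -⟩ ⟨-, hx'⟩
    exact hx' (Set.mem_iUnion₂.2 ⟨i, hij, hx⟩)
  · filter_upwards [h0 i, hmem] with x hx1 hx2 hx
    by_contra hi
    refine hx ⟨⟨by_contra fun h => hi (hx1 h), hi⟩, fun hj => ?_⟩
    obtain ⟨j, hji, hj⟩ := Set.mem_iUnion₂.1 hj
    obtain ⟨k, hk1, hk2⟩ := ((hx2 i hi).and (hx2 j hj)).exists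
    exact Set.disjoint_left.1 ((hp k).1.2.2 hji) hk2 hk1
  · have hSm := (hΩ.inter (hne i)).diff
      (MeasurableSet.iUnion fun j => MeasurableSet.iUnion fun _ : j ≠ i => hne j)
    have := tendsto_measure_of_ae_tendsto_indicator atTop (μ := volume) MeasurableSet.empty
      (fun k => hSm.diff ((hp k).1.1 i)) hΩ hfin.ne
      (Eventually.of_forall fun k => Set.sdiff_subset.trans
        (Set.sdiff_subset.trans Set.inter_subset_left)) (by
        filter_upwards [hmem] with x hx
        by_cases hi : a i x = 0
        · exact Eventually.of_forall fun k => by simp [hi]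
        · filter_upwards [hx i hi] with k hk
          simp [hk])
    simpa using this

/-- The direct method: the functional attains its minimum if the term depending on the sets is
bounded below and lower semicontinuous up to enlarging the limit sets. -/
theorem exists_minimizer (hn : 1 ≤ n) (hΩ : MeasurableSet Ω) (hfin : volume Ω < ⊤)
    (hf : ∀ i, MemLp (f i) ⊤ (volume.restrict Ω))
    (hf0 : ∀ i, ∀ᵐ x ∂(volume.restrict Ω), 0 ≤ f i x)
    (hg : ∀ i, MemLp (g i) 2 (volume.restrict Ω))
    {F : (Fin N → Set (EuclideanSpace ℝ (Fin n))) → ℝ} {B : ℝ}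
    (hB : ∀ W ∈ disjointTuples N Ω, B ≤ F W)
    (hF : ∀ Wk : ℕ → Fin N → Set (EuclideanSpace ℝ (Fin n)), (∀ k, Wk k ∈ disjointTuples N Ω) →
      ∀ S ∈ disjointTuples N Ω, (∀ i, Tendsto (fun k => volume (S i \ Wk k i)) atTop (𝓝 0)) →
      ∀ (ck : ℕ → ℝ) (c : ℝ), (∀ k, F (Wk k) ≤ ck k) → Tendsto ck atTop (𝓝 c) →
      ∃ W ∈ disjointTuples N Ω, (∀ i, S i ⊆ W i) ∧ F W ≤ c) :
    ∃ p₀ ∈ admissiblePairs N Ω, ∀ p ∈ admissiblePairs N Ω,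
      functionalJ Ω f g F p₀ ≤ functionalJ Ω f g F p := by
  choose K hK0 hK using fun i => exists_componentEnergy_ge hn hΩ hfin (hf i) (hf0 i) (hg i)
  have hKp : ∀ p ∈ admissiblePairs N Ω, ∀ i,
      (eLpNorm (weakGradient (p.1 i)) 2 volume).toReal ^ 2 / 2 - K i ≤
        componentEnergy Ω (f i) (g i) (p.1 i) := fun p hp i =>
    hK i _ (hp.2.1 i) (ae_eq_zero_off_of_mem_admissiblePairs hp i)
  have hgrad : ∀ p ∈ admissiblePairs N Ω, ∀ i,
      (eLpNorm (weakGradient (p.1 i)) 2 volume).toReal ^ 2 / 2 ≤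
        functionalJ Ω f g F p - B + ∑ j, K j := by
    intro p hp i
    have h1 : (eLpNorm (weakGradient (p.1 i)) 2 volume).toReal ^ 2 / 2 ≤
        ∑ j, (componentEnergy Ω (f j) (g j) (p.1 j) + K j) := by
      refine le_trans ?_ (Finset.single_le_sum (f := fun j =>
        componentEnergy Ω (f j) (g j) (p.1 j) + K j) (fun j _ => ?_) (Finset.mem_univ i))
      · linarith [hKp p hp i]
      · have := hKp p hp j
        have := sq_nonneg (eLpNorm (weakGradient (p.1 j)) 2 volume).toReal
        linarith
    rw [Finset.sum_add_distrib] at h1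
    rw [functionalJ_eq]
    linarith [hB _ hp.1]
  set J := functionalJ Ω f g F '' admissiblePairs N Ω with hJ
  have hJne : J.Nonempty := ⟨_, _, zero_mem_admissiblePairs, rfl⟩
  have hJb : BddBelow J := by
    refine ⟨B - ∑ j, K j, ?_⟩
    rintro _ ⟨p, hp, rfl⟩
    rw [functionalJ_eq]
    have : ∑ j, -K j ≤ ∑ j, componentEnergy Ω (f j) (g j) (p.1 j) :=
      Finset.sum_le_sum fun j _ => by
        have := hKp p hp j
        have := sq_nonneg (eLpNorm (weakGradient (p.1 j)) 2 volume).toReal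
        linarith
    rw [Finset.sum_neg_distrib] at this
    linarith [hB _ hp.1]
  set m := sInf J with hm
  have hseq : ∀ k : ℕ, ∃ p ∈ admissiblePairs N Ω, functionalJ Ω f g F p < m + 1 / ((k : ℝ) + 1) := by
    intro k
    obtain ⟨_, ⟨p, hp, rfl⟩, h⟩ := exists_lt_of_csInf_lt hJne
      (show sInf J < m + 1 / ((k : ℝ) + 1) from lt_add_of_pos_right _ (by positivity))
    exact ⟨p, hp, h⟩
  choose p hp hpm using hseq
  have hGm : ∀ k i, MemLp (weakGradient ((p k).1 i)) 2 volume := fun k i =>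
    ((hp k).2.1 i).memLp_weakGradient
  have hum : ∀ k i, MemLp ((p k).1 i) 2 volume := fun k i =>
    memLp_of_mem_admissiblePairs hn hΩ hfin (hp k) i
  set a := fun k i => (hum k i).toLp ((p k).1 i) with ha
  set b := fun k i => (hGm k i).toLp (weakGradient ((p k).1 i)) with hb
  have hgr : ∀ k i, HasWeakGradient (a k i) (b k i) := by
    intro k i
    have h1 := ((hp k).2.1 i).hasWeakGradient.congr_ae (hum k i).coeFn_toLp.symm
    refine ⟨h1.1, h1.2.1.congr (hGm k i).coeFn_toLp.symm, fun φ h2 h3 z => ?_⟩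
    rw [h1.2.2 φ h2 h3 z]
    congr 1
    refine integral_congr_ae ?_
    filter_upwards [(hGm k i).coeFn_toLp] with x hx
    rw [hx]
  have hoff : ∀ k i, ∀ᵐ x, x ∉ Ω → a k i x = 0 := by
    intro k i
    filter_upwards [(hum k i).coeFn_toLp, ae_eq_zero_off_of_mem_admissiblePairs (hp k) i]
      with x h1 h2 hx
    rw [h1, h2 hx]
  -- The bound comes from `hgrad` together with J < m + 1 along the minimizing sequence.
  have hbC : ∀ k i, ‖b k i‖ ≤ √(2 * (m + 1 - B + ∑ j, K j)) := by
    intro k i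
    refine Real.le_sqrt_of_sq_le ?_
    have h1 := hgrad _ (hp k) i
    have h2 : 1 / ((k : ℝ) + 1) ≤ 1 := by
      rw [div_le_one (by positivity)]
      linarith [Nat.cast_nonneg (α := ℝ) k]
    rw [hb, Lp.norm_toLp]
    linarith [hpm k]
  obtain ⟨P, hP⟩ := exists_poincare_constant hn hΩ hfin
  have haC : ∀ k i, ‖a k i‖ ≤ P * √(2 * (m + 1 - B + ∑ j, K j)) := by
    intro k i
    refine le_trans ?_ (mul_le_mul_of_nonneg_left (hbC k i) P.coe_nonneg)
    have := hP _ _ (hgr k i) (Lp.memLp _) (hoff k i)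
    have := ENNReal.toReal_mono (ENNReal.mul_ne_top ENNReal.coe_ne_top (Lp.memLp _).2.ne) this
    simpa [Lp.norm_def] using this
  -- A finite exponent is what makes the `Lp` spaces separable, as weak sequential compactness
  -- requires.
  have : Fact ((2 : ENNReal) ≠ ⊤) := ⟨ENNReal.ofNat_ne_top⟩
  obtain ⟨b', s₁, hs₁, hb'⟩ := exists_weak_limit_pi b hbC
  obtain ⟨a', s₂, hs₂, ha'⟩ := exists_weak_limit_pi (fun k => a (s₁ k)) fun k => haC (s₁ k)
  have hbw : ∀ i q, Tendsto (fun k => inner ℝ (b (s₁ (s₂ k)) i) q) atTop (𝓝 (inner ℝ (b' i) q)) :=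
    fun i q => (hb' i q).comp hs₂.tendsto_atTop
  have hgr' : ∀ i, HasWeakGradient (a' i) (b' i) := fun i =>
    hasWeakGradient_of_tendsto_inner (fun k => hgr (s₁ (s₂ k)) i) (ha' i) (hbw i)
  have hoff' : ∀ i, ∀ᵐ x, x ∉ Ω → a' i x = 0 := fun i =>
    ae_eq_zero_of_tendsto_inner hΩ (fun k => hoff (s₁ (s₂ k)) i) (ha' i)
  have hstrong : ∀ i, Tendsto (fun k => eLpNorm (fun x => a (s₁ (s₂ k)) i x - a' i x) 2 volume)
      atTop (𝓝 0) := fun i =>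
    tendsto_eLpNorm_sub_of_tendsto_inner hn hΩ hfin (fun k => hgr (s₁ (s₂ k)) i)
      (fun k => hbC _ i) (fun k => hoff _ i) (ha' i) (hbw i)
  -- The L² distances are summed over the components, so that one extraction gives a.e. convergence
  -- of all of them.
  obtain ⟨s₃, hs₃, hae⟩ : ∃ s₃ : ℕ → ℕ, StrictMono s₃ ∧ ∀ᵐ x, ∀ i,
      Tendsto (fun k => a (s₁ (s₂ (s₃ k))) i x) atTop (𝓝 (a' i x)) := by
    have hmeas : ∀ k i, AEStronglyMeasurable (fun x => ‖a (s₁ (s₂ k)) i x - a' i x‖) volume :=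
      fun k i => ((Lp.aestronglyMeasurable _).sub (Lp.aestronglyMeasurable _)).norm
    have hsum : Tendsto (fun k => eLpNorm
        ((fun x => ∑ i, ‖a (s₁ (s₂ k)) i x - a' i x‖) - fun _ => (0 : ℝ)) 2 volume) atTop (𝓝 0) := by
      have h1 : Tendsto (fun k => ∑ i, eLpNorm (fun x => a (s₁ (s₂ k)) i x - a' i x) 2 volume)
          atTop (𝓝 0) := by
        simpa using tendsto_finsetSum Finset.univ fun i _ => hstrong i
      refine tendsto_of_tendsto_of_tendsto_of_le_of_le tendsto_const_nhds h1 (fun _ => zero_le)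
        fun k => ?_
      have h2 := eLpNorm_sum_le (p := 2) (μ := volume) (s := (Finset.univ : Finset (Fin N)))
        (f := fun i x => ‖a (s₁ (s₂ k)) i x - a' i x‖) (fun i _ => hmeas k i) one_le_two
      simp only [eLpNorm_norm] at h2
      refine le_trans (le_of_eq ?_) h2
      congr 1
      ext x
      simp
    have h3 := tendstoInMeasure_of_tendsto_eLpNorm two_ne_zero (fun k =>
      Finset.aestronglyMeasurable_fun_sum Finset.univ fun i _ => hmeas k i)
      aestronglyMeasurable_const hsum
    obtain ⟨s₃, hs₃, h4⟩ := h3.exists_seq_tendsto_ae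
    refine ⟨s₃, hs₃, ?_⟩
    filter_upwards [h4] with x hx i
    rw [tendsto_iff_norm_sub_tendsto_zero]
    exact squeeze_zero (fun _ => norm_nonneg _) (fun k => Finset.single_le_sum
      (f := fun i => ‖a (s₁ (s₂ (s₃ k))) i x - a' i x‖) (fun _ _ => norm_nonneg _)
      (Finset.mem_univ i)) hx
  set s := fun k => s₁ (s₂ (s₃ k)) with hs
  have hs_mono : StrictMono s := hs₁.comp (hs₂.comp hs₃)
  have hae' : ∀ᵐ x, ∀ i, Tendsto (fun k => (p (s k)).1 i x) atTop (𝓝 (a' i x)) := by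
    have : ∀ᵐ x, ∀ k i, a k i x = (p k).1 i x :=
      ae_all_iff.2 fun k => ae_all_iff.2 fun i => (hum k i).coeFn_toLp
    filter_upwards [hae, this] with x h1 h2 i
    exact (h1 i).congr fun k => h2 _ i
  obtain ⟨S, hS, hSa, hSlim⟩ := exists_disjointTuples_of_ae_tendsto hΩ hfin (fun k => hp (s k))
    (fun i => (Lp.stronglyMeasurable (a' i)).measurable) hoff' hae'
  have hW : ∀ i, MemW12 (a' i) := fun i =>
    ⟨fun A _ => (Lp.memLp (a' i)).restrict A, b' i, hgr' i, Lp.memLp _⟩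
  have hbeq : ∀ i, weakGradient (a' i) =ᵐ[volume] b' i := fun i =>
    (hW i).hasWeakGradient.ae_eq (hgr' i)
  choose Q R hQR using fun i => exists_componentEnergy_add_inner_le hΩ (hf i) (hf0 i) (hg i)
    (Lp.memLp (a' i)) (hW i).memLp_weakGradient
  have ea : ∀ i, (Lp.memLp (a' i)).toLp (a' i) = a' i := fun i => Lp.toLp_coeFn _ _
  have eb : ∀ i, (hW i).memLp_weakGradient.toLp (weakGradient (a' i)) = b' i := fun i =>
    Lp.ext ((MemLp.coeFn_toLp _).trans (hbeq i))
  simp only [ea, eb] at hQR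
  set E := ∑ i, componentEnergy Ω (f i) (g i) (a' i) with hE
  -- F(W_k) need not converge, but it is at most m + 1/(k + 1) minus the tangents evaluated at the
  -- k-th functions. By weak convergence this bound tends to m - E, where E is the energy of the
  -- limit, so the limit pair has J ≤ m.
  obtain ⟨W, hWd, hSW, hFW⟩ := hF (fun k => (p (s k)).2) (fun k => (hp (s k)).1) S hS hSlim
    (fun k => m + 1 / ((s k : ℝ) + 1) - ∑ i, (componentEnergy Ω (f i) (g i) (a' i) +
      (inner ℝ (a (s k) i) (Q i) - inner ℝ (a' i) (Q i)) +
      (inner ℝ (b (s k) i) (R i) - inner ℝ (b' i) (R i)))) (m - E) (fun k => by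
        have h1 := hpm (s k)
        rw [functionalJ_eq] at h1
        have h2 := Finset.sum_le_sum fun i (_ : i ∈ Finset.univ) =>
          hQR i ((p (s k)).1 i) (hum _ i) (hGm _ i)
        linarith) (by
        have h1 : Tendsto (fun k => 1 / ((s k : ℝ) + 1)) atTop (𝓝 0) :=
          tendsto_one_div_add_atTop_nhds_zero_nat.comp hs_mono.tendsto_atTop
        have h2 : ∀ i, Tendsto (fun k => componentEnergy Ω (f i) (g i) (a' i) +
            (inner ℝ (a (s k) i) (Q i) - inner ℝ (a' i) (Q i)) +
            (inner ℝ (b (s k) i) (R i) - inner ℝ (b' i) (R i))) atTop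
            (𝓝 (componentEnergy Ω (f i) (g i) (a' i))) := by
          intro i
          have t1 := (((ha' i (Q i)).comp hs₃.tendsto_atTop).sub_const (inner ℝ (a' i) (Q i)))
          have t2 := (((hbw i (R i)).comp hs₃.tendsto_atTop).sub_const (inner ℝ (b' i) (R i)))
          simpa [Function.comp_def] using (t1.const_add _).add t2
        simpa using (h1.const_add m).sub (tendsto_finsetSum Finset.univ fun i _ => h2 i))
  refine ⟨(fun i => a' i, W), ⟨hWd, hW, fun i => ?_⟩, fun q hq => ?_⟩
  · rw [ae_restrict_iff' (hWd.1 i).compl]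
    filter_upwards [hSa i] with x hx h
    exact hx fun h' => h (hSW i h')
  · have : m ≤ functionalJ Ω f g F q := csInf_le hJb ⟨q, hq, rfl⟩
    refine le_trans ?_ this
    rw [functionalJ_eq]
    dsimp only
    linarith

end Minimization

/-! ### Semicontinuity of the two kinds of set terms. -/

section SetTerms

variable {n N : ℕ} {Ω : Set (EuclideanSpace ℝ (Fin n))}

theorem volume_real_mem_Icc (hfin : volume Ω < ⊤) {W : Fin N → Set (EuclideanSpace ℝ (Fin n))}
    (hW : W ∈ disjointTuples N Ω) :
    (fun i => volume.real (W i)) ∈ Set.univ.pi fun _ : Fin N => Set.Icc 0 (volume.real Ω) :=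
  fun i _ => ⟨measureReal_nonneg, measureReal_mono (hW.2.1 i) hfin.ne⟩

theorem sum_volume_real_le (hfin : volume Ω < ⊤) {W : Fin N → Set (EuclideanSpace ℝ (Fin n))}
    (hW : W ∈ disjointTuples N Ω) : ∑ i, volume.real (W i) ≤ volume.real Ω := by
  have hfi : ∀ i, volume (W i) ≠ ⊤ := fun i => measure_ne_top_of_subset (hW.2.1 i) hfin.ne
  have h := measureReal_biUnion_finset (μ := volume) (s := Finset.univ) (f := W)
    (fun i _ j _ hij => hW.2.2 hij) (fun i _ => hW.1 i) fun i _ => hfi i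
  rw [← h]
  exact measureReal_mono (Set.iUnion₂_subset fun i _ => hW.2.1 i) hfin.ne

/-- Disjoint sets can be enlarged to disjoint sets of prescribed larger volumes. -/
theorem exists_disjointTuples_superset (hn : 1 ≤ n) (hΩ : MeasurableSet Ω) (hfin : volume Ω < ⊤)
    {S : Fin N → Set (EuclideanSpace ℝ (Fin n))} (hS : S ∈ disjointTuples N Ω) {V : Fin N → ℝ}
    (hSV : ∀ i, volume.real (S i) ≤ V i) (hV : ∑ i, V i ≤ volume.real Ω) :
    ∃ W ∈ disjointTuples N Ω, (∀ i, S i ⊆ W i) ∧ ∀ i, volume.real (W i) = V i := by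
  have hSU : MeasurableSet (⋃ i, S i) := MeasurableSet.iUnion hS.1
  have hSΩ : (⋃ i, S i) ⊆ Ω := Set.iUnion_subset hS.2.1
  have hfi : ∀ i, volume (S i) ≠ ⊤ := fun i => measure_ne_top_of_subset (hS.2.1 i) hfin.ne
  have hU : volume.real (⋃ i, S i) = ∑ i, volume.real (S i) := by
    have h := measureReal_biUnion_finset (μ := volume) (s := Finset.univ) (f := S)
      (fun i _ j _ hij => hS.2.2 hij) (fun i _ => hS.1 i) fun i _ => hfi i
    simpa using h
  have hR : volume.real (Ω \ ⋃ i, S i) = volume.real Ω - ∑ i, volume.real (S i) := by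
    rw [measureReal_sdiff hSΩ hSU hfin.ne, hU]
  have hRfin : volume (Ω \ ⋃ i, S i) < ⊤ := (measure_mono Set.sdiff_subset).trans_lt hfin
  -- The missing volumes V_i - |S_i| fit into the part of Ω not covered by S because the V_i sum to
  -- at most |Ω|.
  obtain ⟨T, hT, hTd⟩ := exists_pairwise_disjoint_volume_eq hn Finset.univ (hΩ.diff hSU) hRfin
    (d := fun i => V i - volume.real (S i)) (fun i _ => sub_nonneg.2 (hSV i)) (by
      rw [Finset.sum_sub_distrib, hR]
      linarith)
  have hST : ∀ i j, Disjoint (S i) (T j) := fun i j =>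
    (Set.disjoint_sdiff_right.mono_right (hT j (Finset.mem_univ j)).2.1).mono_left
      (Set.subset_iUnion S i)
  refine ⟨fun i => S i ∪ T i, ⟨fun i => (hS.1 i).union (hT i (Finset.mem_univ i)).1, fun i =>
    Set.union_subset (hS.2.1 i) ((hT i (Finset.mem_univ i)).2.1.trans Set.sdiff_subset),
    fun i j hij => ?_⟩, fun i => Set.subset_union_left, fun i => ?_⟩
  · have h := hTd (Finset.mem_coe.2 (Finset.mem_univ i)) (Finset.mem_coe.2 (Finset.mem_univ j)) hij
    exact Disjoint.union_left ((hS.2.2 hij).union_right (hST i j))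
      ((hST j i).symm.union_right h)
  · have hTfin : volume (T i) ≠ ⊤ :=
      measure_ne_top_of_subset (hT i (Finset.mem_univ i)).2.1 hRfin.ne
    rw [measureReal_union (hST i i) (hT i (Finset.mem_univ i)).1 (hfi i) hTfin,
      (hT i (Finset.mem_univ i)).2.2]
    ring

/-- By compactness the volumes of the W_k converge along a subsequence to some V. Asymptotic
covering gives |S_i| ≤ V_i, and disjointness gives ∑ V_i ≤ |Ω|, so S can be enlarged to have exactly
the volumes V. Then Ft takes its limit value, by continuity. -/
theorem exists_le_of_continuousOn_volume (hn : 1 ≤ n) (hΩ : MeasurableSet Ω) (hfin : volume Ω < ⊤)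
    {Ft : (Fin N → ℝ) → ℝ}
    (hFt : ContinuousOn Ft (Set.univ.pi fun _ => Set.Icc 0 (volume.real Ω)))
    {Wk : ℕ → Fin N → Set (EuclideanSpace ℝ (Fin n))} (hWk : ∀ k, Wk k ∈ disjointTuples N Ω)
    {S : Fin N → Set (EuclideanSpace ℝ (Fin n))} (hS : S ∈ disjointTuples N Ω)
    (hlim : ∀ i, Tendsto (fun k => volume (S i \ Wk k i)) atTop (𝓝 0)) {ck : ℕ → ℝ} {c : ℝ}
    (hle : ∀ k, Ft (fun i => volume.real (Wk k i)) ≤ ck k) (hc : Tendsto ck atTop (𝓝 c)) :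
    ∃ W ∈ disjointTuples N Ω, (∀ i, S i ⊆ W i) ∧ Ft (fun i => volume.real (W i)) ≤ c := by
  obtain ⟨V, hV, s, hs, hsV⟩ := (isCompact_univ_pi fun _ : Fin N =>
    isCompact_Icc (a := (0 : ℝ)) (b := volume.real Ω)).isSeqCompact
    fun k => volume_real_mem_Icc hfin (hWk k)
  have hVi : ∀ i, Tendsto (fun k => volume.real (Wk (s k) i)) atTop (𝓝 (V i)) := fun i =>
    (tendsto_pi_nhds.1 hsV) i
  have hSV : ∀ i, volume.real (S i) ≤ V i := by
    intro i
    have h1 : Tendsto (fun k => volume.real (S i \ Wk (s k) i)) atTop (𝓝 0) :=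
      (ENNReal.tendsto_toReal ENNReal.zero_ne_top).comp ((hlim i).comp hs.tendsto_atTop)
    have h2 := h1.add (hVi i)
    rw [zero_add] at h2
    refine ge_of_tendsto' h2 fun k => ?_
    have hWfin : volume (Wk (s k) i) ≠ ⊤ := measure_ne_top_of_subset ((hWk (s k)).2.1 i) hfin.ne
    have hSfin : volume (S i \ Wk (s k) i) ≠ ⊤ :=
      measure_ne_top_of_subset (Set.sdiff_subset.trans (hS.2.1 i)) hfin.ne
    refine le_trans (measureReal_mono ?_ (measure_union_ne_top hSfin hWfin))
      (measureReal_union_le _ _)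
    rw [Set.sdiff_union_self]
    exact Set.subset_union_left
  have hsum : ∑ i, V i ≤ volume.real Ω :=
    le_of_tendsto' (tendsto_finsetSum Finset.univ fun i _ => hVi i) fun k =>
      sum_volume_real_le hfin (hWk (s k))
  obtain ⟨W, hW, hSW, hWV⟩ := exists_disjointTuples_superset hn hΩ hfin hS hSV hsum
  refine ⟨W, hW, hSW, ?_⟩
  simp only [hWV]
  have hFlim : Tendsto (fun k => Ft fun i => volume.real (Wk (s k) i)) atTop (𝓝 (Ft V)) :=
    (hFt V hV).tendsto.comp (tendsto_nhdsWithin_iff.2 ⟨hsV, Eventually.of_forall fun k =>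
      volume_real_mem_Icc hfin (hWk (s k))⟩)
  exact le_of_tendsto_of_tendsto' hFlim (hc.comp hs.tendsto_atTop) fun k => hle (s k)

/-- The tuple S ∩ W_k differs from S exactly by S \ W_k, so F(S ∩ W_k) → F(S) by continuity; and F(S
∩ W_k) ≤ F(W_k) by monotonicity. -/
theorem le_of_isMonotoneTerm_of_isContinuousTerm
    {F : (Fin N → Set (EuclideanSpace ℝ (Fin n))) → ℝ} (hmono : IsMonotoneTerm Ω F)
    (hcont : IsContinuousTerm Ω F)
    {Wk : ℕ → Fin N → Set (EuclideanSpace ℝ (Fin n))} (hWk : ∀ k, Wk k ∈ disjointTuples N Ω)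
    {S : Fin N → Set (EuclideanSpace ℝ (Fin n))} (hS : S ∈ disjointTuples N Ω)
    (hlim : ∀ i, Tendsto (fun k => volume (S i \ Wk k i)) atTop (𝓝 0)) {ck : ℕ → ℝ} {c : ℝ}
    (hle : ∀ k, F (Wk k) ≤ ck k) (hc : Tendsto ck atTop (𝓝 c)) : F S ≤ c := by
  have hI : ∀ k, (fun i => S i ∩ Wk k i) ∈ disjointTuples N Ω := fun k =>
    ⟨fun i => (hS.1 i).inter ((hWk k).1 i), fun i => Set.inter_subset_left.trans (hS.2.1 i),
      fun i j hij => (hS.2.2 hij).mono Set.inter_subset_left Set.inter_subset_left⟩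
  have h := hcont S hS (fun k i => S i ∩ Wk k i) hI fun i => by
    refine (hlim i).congr fun k => ?_
    rw [Set.symmDiff_def, Set.sdiff_self_inter, Set.sdiff_eq_empty.2 Set.inter_subset_left,
      Set.union_empty]
  exact le_of_tendsto_of_tendsto' h hc fun k =>
    (hmono _ (hI k) _ (hWk k) fun i => Set.inter_subset_right).trans (hle k)

end SetTerms

end Partition
-- The theorem.
theorem theorem3p1 (n N : ℕ) (hn : 1 ≤ n) (hN : 1 ≤ N)
    (Ω : Set (EuclideanSpace ℝ (Fin n))) (hΩ : MeasurableSet Ω) (hΩfin : volume Ω < ⊤)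
    (f g : Fin N → EuclideanSpace ℝ (Fin n) → ℝ)
    (hf : ∀ i, MemLp (f i) ⊤ (volume.restrict Ω))
    (hf_nonneg : ∀ i, ∀ᵐ x ∂(volume.restrict Ω), 0 ≤ f i x)
    (hg : ∀ i, MemLp (g i) 2 (volume.restrict Ω)) :
    -- the integrals that define `J` converge on the class of admissible pairs
    (∀ p ∈ Partition.admissiblePairs N Ω, ∀ i,
      Integrable (fun x => ‖Partition.weakGradient (p.1 i) x‖ ^ 2) volume ∧
      IntegrableOn (fun x => p.1 i x ^ 2 * f i x) Ω volume ∧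
      IntegrableOn (fun x => p.1 i x * g i x) Ω volume) ∧
    -- `F` is a continuous function of the volumes
    (∀ Ft : (Fin N → ℝ) → ℝ,
      ContinuousOn Ft (Set.univ.pi fun _ => Set.Icc 0 (volume.real Ω)) →
      ∃ p₀ ∈ Partition.admissiblePairs N Ω, ∀ p ∈ Partition.admissiblePairs N Ω,
        Partition.functionalJ Ω f g (fun W => Ft fun i => volume.real (W i)) p₀ ≤
          Partition.functionalJ Ω f g (fun W => Ft fun i => volume.real (W i)) p) ∧
    -- `F` is a continuous and nondecreasing function of the sets
    (∀ F : (Fin N → Set (EuclideanSpace ℝ (Fin n))) → ℝ,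
      Partition.IsMonotoneTerm Ω F → Partition.IsContinuousTerm Ω F →
      ∃ p₀ ∈ Partition.admissiblePairs N Ω, ∀ p ∈ Partition.admissiblePairs N Ω,
        Partition.functionalJ Ω f g F p₀ ≤ Partition.functionalJ Ω f g F p) := by

  refine ⟨fun p hp i => ?_, fun Ft hFt => ?_, fun F hmono hcont => ?_⟩
  · have hu := (Partition.memLp_of_mem_admissiblePairs hn hΩ hΩfin hp i).restrict Ω
    exact ⟨Partition.integrable_norm_sq (hp.2.1 i).memLp_weakGradient,
      Partition.integrable_sq_mul hu (hf i), Partition.integrable_mul_of_memLp_two hu (hg i)⟩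
  -- The lower bound for F is the minimum principle on the compact cube of possible volumes.
  · obtain ⟨B, hB⟩ := (isCompact_univ_pi fun _ : Fin N =>
      isCompact_Icc (a := (0 : ℝ)) (b := volume.real Ω)).bddBelow_image hFt
    exact Partition.exists_minimizer hn hΩ hΩfin hf hf_nonneg hg
      (fun W hW => hB ⟨_, Partition.volume_real_mem_Icc hΩfin hW, rfl⟩)
      fun Wk hWk S hS hlim ck c hle hc =>
        Partition.exists_le_of_continuousOn_volume hn hΩ hΩfin hFt hWk hS hlim hle hc
  -- Here the lower bound is the value of F at the empty tuple, and no enlargement of S is needed.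
  · exact Partition.exists_minimizer hn hΩ hΩfin hf hf_nonneg hg
      (fun W hW => hmono _ Partition.empty_mem_disjointTuples W hW fun i => Set.empty_subset _)
      fun Wk hWk S hS hlim ck c hle hc => ⟨S, hS, fun i => subset_rfl,
        Partition.le_of_isMonotoneTerm_of_isContinuousTerm hmono hcont hWk hS hlim hle hc⟩
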